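/- Let $K\ge 2$ and $1\le B\le K$. Consider $K$ users, $K$ relays and one server; user $k$ is connected to the $B$ cyclically consecutive relays $\mathcal B_k=\{k,k+1,\dots,k+B-1\}$ (indices modulo $K$), and $\mathcal U_i=\{k: i\in\mathcal B_k\}$ denotes the set of users connected to relay $i$. Let $\mathbb F_q$ be a finite field; entropies and mutual informations are in $q$-ary units. A *scheme* over $\mathbb F_q$ consists of an input length $L\ge 1$ and jointly distributed random variables: inputs $W_k\in\mathbb F_q^{L}$, individual keys $Z_k\in\mathbb F_q^{L_Z}$, a source key $Z_\Sigma\in\mathbb F_q^{L_{Z_\Sigma}}$, user-to-relay messages $X_{k,i}\in\mathbb F_q^{L_{X,k,i}}$ ($i\in\mathcal B_k$) with the same total length $L_X=\sum_{i\in\mathcal B_k}L_{X,k,i}$ for every user $k$, and relay-to-server messages $Y_i\in\mathbb F_q^{L_{Y,i}}$, such that $H(W_k)=L$ for all $k$, $H(W_{1:K})=\sum_k H(W_k)$, $H(Z_{1:K}\mid Z_\Sigma)=0$, $H(W_{1:K},Z_{1:K})=\sum_k H(W_k)+H(Z_{1:K})$, $H((X_{k,i})_{i\in\mathcal B_k}\mid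 W_k,Z_k)=0$ for all $k$, $H(Y_i\mid (X_{k,i})_{k\in\mathcal U_i})=0$ for all $i$, $H(\sum_k W_k\mid Y_{1:K})=0$ (recovery), $I(Y_{1:K};W_{1:K}\mid\sum_k W_k)=0$ (server security), and $I((X_{k,i})_{k\in\mathcal U_i};W_{1:K})=0$ for all $i$ (relay security). Its rate tuple is $(R_X,R_Y,R_Z,R_{Z_\Sigma})=\big(\tfrac{L_X}{L},\tfrac{\sum_i L_{Y,i}}{KL},\tfrac{L_Z}{L},\tfrac{L_{Z_\Sigma}}{L}\big)$. A tuple is *achievable* over $\mathbb F_q$ if it is the rate tuple of some scheme over $\mathbb F_q$, and the *optimal rate region* $\mathcal R^*$ (over $\mathbb F_q$) is the closure in $\mathbb R^4$ of the set of achievable tuples. **Theorem.** (a) Let $1\le B\le K-1$. Over every finite field, every tuple in $\mathcal R^*$ satisfies $R_X\ge 1$, $R_Y\ge 1/B$, $R_Z\ge 1/B$, $R_{Z_\Sigma}\ge\max\{1,K/B-1\}$; and there is $q_0=q_0(K,B)$ such that over every finite field with $q\ge q_0$, $$\mathcal R^*=\Big\{(R_X,R_Y,R_Z,R_{Z_\Sigma}):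 R_X\ge 1,\ R_Y\ge \tfrac1B,\ R_Z\ge\tfrac1B,\ R_{Z_\Sigma}\ge\max\{1,\tfrac KB-1\}\Big\}.$$ (b) Let $B=K$. Over every finite field, every tuple in $\mathcal R^*$ satisfies $R_X\ge 1$, $R_Y\ge \frac1{K-1}$, $R_Z\ge\frac1K$ and $R_{Z_\Sigma}\ge 1$. There is $q_0=q_0(K)$ such that over every finite field with $q\ge q_0$ the tuple $\big(1,\frac1{K-1},\frac1{K-1},1\big)$ is achievable; $1$, $\frac1{K-1}$ and $1$ are the minimum values of $R_X$, $R_Y$ and $R_{Z_\Sigma}$, respectively, over $\mathcal R^*$; and $\frac1{K-1}$ is at most twice the infimum of $R_Z$ over $\mathcal R^*$. -/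

import Mathlib

open MeasureTheory

namespace HSA

noncomputable section

section Entropy

variable {Ω S T U : Type} [MeasurableSpace Ω] [Fintype S] [Fintype T] [Fintype U]

/-- A random variable with values in a finite alphabet: every event `{X = s}` is measurable. -/
def IsRandomVar {Ω S : Type} [MeasurableSpace Ω] (X : Ω → S) : Prop :=
  ∀ s : S, MeasurableSet (X ⁻¹' {s})

/-- The probability `P(X = s)`. -/
def prob (μ : Measure Ω) {S : Type} (X : Ω → S) (s : S) : ℝ := μ.real (X ⁻¹' {s})

/-- Shannon entropy `H(X) = -∑ P(X=s) log_q P(X=s)`, in `q`-ary units. -/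
def entropy (q : ℕ) (μ : Measure Ω) (X : Ω → S) : ℝ :=
  -∑ s, prob μ X s * Real.logb q (prob μ X s)

/-- Conditional entropy `H(X|Y) = -∑ P(X=s,Y=t) log_q (P(X=s,Y=t) / P(Y=t))`.  Terms with
`P(X=s,Y=t) = 0` contribute `0`, as usual. -/
def condEntropy (q : ℕ) (μ : Measure Ω) (X : Ω → S) (Y : Ω → T) : ℝ :=
  -∑ s, ∑ t, prob μ (fun ω => (X ω, Y ω)) (s, t) *
    Real.logb q (prob μ (fun ω => (X ω, Y ω)) (s, t) / prob μ Y t)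

/-- Mutual information `I(X;Y) = H(X) - H(X|Y)`. -/
def mutualInfo (q : ℕ) (μ : Measure Ω) (X : Ω → S) (Y : Ω → T) : ℝ :=
  entropy q μ X - condEntropy q μ X Y

/-- Conditional mutual information `I(X;Y|V) = H(X|V) - H(X|Y,V)`. -/
def condMutualInfo (q : ℕ) (μ : Measure Ω) (X : Ω → S) (Y : Ω → T) (V : Ω → U) : ℝ :=
  condEntropy q μ X V - condEntropy q μ X (fun ω => (Y ω, V ω))

end Entropy

/-- Relays of user `k`: the `B` cyclically consecutive relays `k, k+1, …, k+B-1` modulo `K`.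
(Subtraction in `Fin K` is subtraction modulo `K`; users and relays are numbered from `0`.) -/
def relaysOf (K B : ℕ) (k : Fin K) : Finset (Fin K) :=
  Finset.univ.filter fun i => ((i - k : Fin K) : ℕ) < B

/-- Users of relay `i`: the `B` cyclically consecutive users `i-B+1, …, i` modulo `K`. -/
def usersOf (K B : ℕ) (i : Fin K) : Finset (Fin K) :=
  Finset.univ.filter fun k => ((i - k : Fin K) : ℕ) < B

/-- A secure aggregation scheme for `K` users and `K` relays with cyclic association number `B`,
over the finite field `F`.  The message `X k i` is part of the scheme only for
`i ∈ relaysOf K B k`; the remaining values of `X` and `LX` are unused. -/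
structure Scheme (K B : ℕ) (F : Type) [Field F] [Fintype F] where
  /-- the underlying probability space -/
  Ω : Type
  [measurableSpace : MeasurableSpace Ω]
  μ : Measure Ω
  [isProbabilityMeasure : IsProbabilityMeasure μ]
  /-- number of symbols of each input -/
  L : ℕ
  L_pos : 0 < L
  /-- number of symbols of the message from user `k` to relay `i` -/
  LX : Fin K → Fin K → ℕ
  /-- total number of symbols sent by each user, the same for all users -/
  LXtot : ℕ
  LX_sum : ∀ k, ∑ i ∈ relaysOf K B k, LX k i = LXtot
  /-- number of symbols of the message from relay `i` to the server -/
  LY : Fin K → ℕ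
  /-- number of symbols of each individual key -/
  LZ : ℕ
  /-- number of symbols of the source key -/
  LS : ℕ
  /-- inputs -/
  W : Fin K → Ω → (Fin L → F)
  /-- individual keys -/
  Z : Fin K → Ω → (Fin LZ → F)
  /-- source key -/
  S : Ω → (Fin LS → F)
  /-- user-to-relay messages -/
  X : (k i : Fin K) → Ω → (Fin (LX k i) → F)
  /-- relay-to-server messages -/
  Y : (i : Fin K) → Ω → (Fin (LY i) → F)
  W_rv : ∀ k, IsRandomVar (W k)
  Z_rv : ∀ k, IsRandomVar (Z k)
  S_rv : IsRandomVar S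
  X_rv : ∀ k i, IsRandomVar (X k i)
  Y_rv : ∀ i, IsRandomVar (Y i)
  /-- the inputs are uniform: `H(W_k) = L` -/
  input_uniform : ∀ k, entropy (Fintype.card F) μ (W k) = L
  /-- the inputs are independent: `H(W_1,…,W_K) = ∑ H(W_k)` -/
  input_indep : entropy (Fintype.card F) μ (fun ω k => W k ω) =
    ∑ k, entropy (Fintype.card F) μ (W k)
  /-- the individual keys are generated from the source key: `H(Z_1,…,Z_K | Z_Σ) = 0` -/
  key_gen : condEntropy (Fintype.card F) μ (fun ω k => Z k ω) S = 0
  /-- keys are independent of inputs: `H(W_{1:K}, Z_{1:K}) = ∑ H(W_k) + H(Z_{1:K})` -/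
  key_input_indep :
    entropy (Fintype.card F) μ (fun ω => ((fun k => W k ω), (fun k => Z k ω))) =
      ∑ k, entropy (Fintype.card F) μ (W k) + entropy (Fintype.card F) μ (fun ω k => Z k ω)
  /-- user encoding: `H((X_{k,i})_{i ∈ B_k} | W_k, Z_k) = 0` -/
  user_encode : ∀ k, condEntropy (Fintype.card F) μ
    (fun ω (i : {i // i ∈ relaysOf K B k}) => X k i ω) (fun ω => (W k ω, Z k ω)) = 0
  /-- relay encoding: `H(Y_i | (X_{k,i})_{k ∈ U_i}) = 0` -/
  relay_encode : ∀ i, condEntropy (Fintype.card F) μ (Y i)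
    (fun ω (k : {k // k ∈ usersOf K B i}) => X k i ω) = 0
  /-- recovery: `H(∑ W_k | Y_{1:K}) = 0` -/
  recovery : condEntropy (Fintype.card F) μ (fun ω => ∑ k, W k ω) (fun ω i => Y i ω) = 0
  /-- server security: `I(Y_{1:K}; W_{1:K} | ∑ W_k) = 0` -/
  server_security : condMutualInfo (Fintype.card F) μ
    (fun ω i => Y i ω) (fun ω k => W k ω) (fun ω => ∑ k, W k ω) = 0
  /-- relay security: `I((X_{k,i})_{k ∈ U_i}; W_{1:K}) = 0` -/
  relay_security : ∀ i, mutualInfo (Fintype.card F) μ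
    (fun ω (k : {k // k ∈ usersOf K B i}) => X k i ω) (fun ω k => W k ω) = 0

/-- The rate tuple `(R_X, R_Y, R_Z, R_{Z_Σ})` of a scheme. -/
def Scheme.rates {K B : ℕ} {F : Type} [Field F] [Fintype F] (s : Scheme K B F) :
    ℝ × ℝ × ℝ × ℝ :=
  ((s.LXtot : ℝ) / s.L, (∑ i, (s.LY i : ℝ)) / (K * s.L), (s.LZ : ℝ) / s.L, (s.LS : ℝ) / s.L)

/-- The set of achievable rate tuples over the field `F`. -/
def achievableRates (K B : ℕ) (F : Type) [Field F] [Fintype F] : Set (ℝ × ℝ × ℝ × ℝ) :=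
  {r | ∃ s : Scheme K B F, s.rates = r}

/-- The optimal rate region over `F`: the closure of the set of achievable rate tuples. -/
def optimalRegion (K B : ℕ) (F : Type) [Field F] [Fintype F] : Set (ℝ × ℝ × ℝ × ℝ) :=
  closure (achievableRates K B F)

/-- The box `R_X ≥ 1`, `R_Y ≥ 1/B`, `R_Z ≥ 1/B`, `R_{Z_Σ} ≥ max {1, K/B - 1}`. -/
def rateBox (K B : ℕ) : Set (ℝ × ℝ × ℝ × ℝ) :=
  {r | 1 ≤ r.1 ∧ 1 / (B : ℝ) ≤ r.2.1 ∧ 1 / (B : ℝ) ≤ r.2.2.1 ∧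
    max 1 ((K : ℝ) / B - 1) ≤ r.2.2.2}

end

end HSA

/-! Converse. The entropy constraints enter only through supports. Call a sample point good if its
joint outcome has positive probability. By the strict form of Gibbs' inequality
(`pos_of_relEntropy_nonpos`), vanishing mutual information makes values that are separately possible
jointly possible; vanishing conditional entropy makes one variable a function of another on good
points. Every bound then becomes a count of values.

Freeze the keys (`Scheme.point`). Changing one input must change the messages of that user and the
outputs of its relays: this gives R_X ≥ 1 and, averaged over users, R_Y ≥ 1/B. Relay security allows
the messages at relay i to be frozen while the inputs vary, so the other K - 1 relays must convey
the sum: R_Y ≥ 1/(K-1). It also allows all inputs to be reset to 0 while the messages at a relay are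
kept, so the keys alone must account for every message value: R_Z ≥ 1/B and R_{Z_Σ} ≥ 1. Server
security moves the whole sum to a single user without changing the outputs, so at most q^(L+LS)
output vectors occur under frozen keys. A Shearer-type inequality (`card_pow_le_card_image_pow`)
shows that at least q^(KL/B) occur, whence R_{Z_Σ} ≥ K/B - 1.

Achievability (`exists_linearCode`, for b < K). Attach distinct nodes to the relays and read the
relay outputs as a polynomial of degree < K, whose top b coefficients are the decoded sum. The noise
of user k is a scalar key times a polynomial vanishing at the nodes of the relays not serving k.
With r = min(b, K-b), these noise polynomials have degree < K - b + r, so r linear constraints on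
the K scalars keep the total noise out of the decoded coefficients, leaving K - r source symbols per
block. For generic parameters the noise fills the kernel of the decoder (server security) and the
keys at each relay are unconstrained (relay security). Repeating blocks and padding with zeros
yields the whole box for B < K; for B = K the code with b = K - 1 gives the corner point. -/

namespace HSA

/-! ### Entropy identities as statements about supports -/

section Support

variable {Ω S T U : Type} [MeasurableSpace Ω] {μ : Measure Ω}

theorem IsRandomVar.comp [Fintype S] {X : Ω → S} (hX : IsRandomVar X) (f : S → T) :
    IsRandomVar fun ω => f (X ω) := by
  intro t
  have : (fun ω => f (X ω)) ⁻¹' {t} = ⋃ s ∈ {s | f s = t}, X ⁻¹' {s} := by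
    ext ω; simp
  rw [this]
  exact MeasurableSet.biUnion (Set.to_countable _) fun s _ => hX s

theorem IsRandomVar.prodMk {X : Ω → S} {Y : Ω → T} (hX : IsRandomVar X) (hY : IsRandomVar Y) :
    IsRandomVar fun ω => (X ω, Y ω) := by
  rintro ⟨s, t⟩
  have : (fun ω => (X ω, Y ω)) ⁻¹' {(s, t)} = X ⁻¹' {s} ∩ Y ⁻¹' {t} := by
    ext ω; simp
  rw [this]
  exact (hX s).inter (hY t)

theorem IsRandomVar.pi {ι : Type} [Countable ι] {A : ι → Type} {X : (i : ι) → Ω → A i}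
    (hX : ∀ i, IsRandomVar (X i)) : IsRandomVar fun ω i => X i ω := by
  intro s
  have : (fun ω i => X i ω) ⁻¹' {s} = ⋂ i, X i ⁻¹' {s i} := by
    ext ω; simp [funext_iff]
  rw [this]
  exact MeasurableSet.iInter fun i => hX i _

theorem prob_nonneg (X : Ω → S) (s : S) : 0 ≤ prob μ X s := measureReal_nonneg

theorem prob_mono [IsProbabilityMeasure μ] {X : Ω → S} {Y : Ω → T} {s : S} {t : T}
    (h : ∀ ω, X ω = s → Y ω = t) : prob μ X s ≤ prob μ Y t :=
  measureReal_mono fun ω hω => h ω hω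

theorem prob_congr {X : Ω → S} {Y : Ω → T} {s : S} {t : T}
    (h : ∀ ω, X ω = s ↔ Y ω = t) : prob μ X s = prob μ Y t := by
  unfold prob
  congr 1
  ext ω
  exact h ω

variable [IsProbabilityMeasure μ]

theorem sum_prob_pair [Fintype T] {X : Ω → S} {Y : Ω → T}
    (hX : IsRandomVar X) (hY : IsRandomVar Y) (s : S) :
    ∑ t, prob μ (fun ω => (X ω, Y ω)) (s, t) = prob μ X s := by
  unfold prob
  rw [← measureReal_biUnion_finset (s := Finset.univ)]
  · congr 1
    ext ω
    simp
  · intro a _ b _ hab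
    refine Set.disjoint_left.2 fun ω h1 h2 => hab ?_
    simp only [Set.mem_preimage, Set.mem_singleton_iff, Prod.mk.injEq] at h1 h2
    exact h1.2.symm.trans h2.2
  · exact fun t _ => hX.prodMk hY _

theorem sum_prob_pair_left [Fintype S] {X : Ω → S} {Y : Ω → T}
    (hX : IsRandomVar X) (hY : IsRandomVar Y) (t : T) :
    ∑ s, prob μ (fun ω => (X ω, Y ω)) (s, t) = prob μ Y t := by
  rw [← sum_prob_pair hY hX t]
  exact Finset.sum_congr rfl fun s _ => prob_congr fun ω => by simp [and_comm]

theorem sum_prob [Fintype S] {X : Ω → S} (hX : IsRandomVar X) : ∑ s, prob μ X s = 1 := by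
  have h := sum_prob_pair_left (μ := μ) (Y := fun _ => ()) hX (fun _ => MeasurableSet.const _) ()
  have h2 : prob μ (fun _ : Ω => ()) () = 1 := by
    unfold prob
    rw [show (fun _ : Ω => ()) ⁻¹' {()} = Set.univ by ext; simp]
    simp
  rw [h2] at h
  rw [← h]
  exact Finset.sum_congr rfl fun s _ => prob_congr fun ω => by simp

/-- If the relative entropy of `p` with respect to `r` is at most `0`, then `r` is supported on
the support of `p`. -/
theorem pos_of_relEntropy_nonpos {ι : Type} [Fintype ι] {q : ℕ} (hq : 1 < q) {p r : ι → ℝ}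
    (hp : ∀ i, 0 ≤ p i) (hr : ∀ i, 0 ≤ r i) (hps : ∑ i, p i = 1) (hrs : ∑ i, r i ≤ 1)
    (hac : ∀ i, 0 < p i → 0 < r i) (h : ∑ i, p i * Real.logb q (p i / r i) ≤ 0)
    (i : ι) (hi : 0 < r i) : 0 < p i := by
  classical
  have hlq : 0 < Real.log q := Real.log_pos (by exact_mod_cast hq)
  have h' : ∑ i, p i * Real.log (p i / r i) ≤ 0 := by
    have : ∑ i, p i * Real.log (p i / r i) = Real.log q * ∑ i, p i * Real.logb q (p i / r i) := by
      rw [Finset.mul_sum]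
      refine Finset.sum_congr rfl fun i _ => ?_
      unfold Real.logb
      field_simp
    rw [this]
    exact mul_nonpos_of_nonneg_of_nonpos hlq.le h
  by_contra hpi
  have hpi0 : p i = 0 := le_antisymm (not_lt.1 hpi) (hp i)
  -- This is log x ≤ x - 1. At a zero of `p` the right side is 0 and the bound p - r loses all of
  -- `r`; recovering that loss at `i` gives the contradiction r i ≤ 0 after summation.
  have key : ∀ j, p j - r j + (if j = i then r i else 0) ≤ p j * Real.log (p j / r j) := by
    intro j
    rcases (hp j).eq_or_lt with h0 | h0
    · rw [← h0]
      split_ifs with hj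
      · simp [hj]
      · simpa using hr j
    · have hji : j ≠ i := fun e => by rw [e, hpi0] at h0; exact lt_irrefl _ h0
      have hrj := hac j h0
      have hl := Real.log_le_sub_one_of_pos (div_pos hrj h0)
      have hinv : Real.log (p j / r j) = - Real.log (r j / p j) := by
        rw [← Real.log_inv, inv_div]
      rw [hinv, if_neg hji]
      have := mul_le_mul_of_nonneg_left hl h0.le
      have e : p j * (r j / p j - 1) = r j - p j := by field_simp
      linarith
  have hsum := Finset.sum_le_sum fun j (_ : j ∈ Finset.univ) => key j
  rw [Finset.sum_add_distrib, Finset.sum_sub_distrib] at hsum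
  simp only [Finset.sum_ite_eq', Finset.mem_univ, if_true] at hsum
  linarith

/-- All summands have one sign, so each vanishes, and a possible pair (s, t) carries the full mass
P(Y = t). Two different such s would exceed that mass. -/
theorem eq_of_condEntropy_eq_zero [Fintype S] [Fintype T] {q : ℕ} (hq : 1 < q)
    {X : Ω → S} {Y : Ω → T} (hX : IsRandomVar X) (hY : IsRandomVar Y)
    (h : condEntropy q μ X Y = 0) {s s' : S} {t : T}
    (hs : 0 < prob μ (fun ω => (X ω, Y ω)) (s, t))
    (hs' : 0 < prob μ (fun ω => (X ω, Y ω)) (s', t)) : s = s' := by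
  classical
  have hle : ∀ s t, prob μ (fun ω => (X ω, Y ω)) (s, t) ≤ prob μ Y t := fun s t =>
    prob_mono fun ω hω => by simpa using congrArg Prod.snd hω
  have hterm : ∀ s t, prob μ (fun ω => (X ω, Y ω)) (s, t) *
      Real.logb q (prob μ (fun ω => (X ω, Y ω)) (s, t) / prob μ Y t) ≤ 0 := by
    intro s t
    refine mul_nonpos_of_nonneg_of_nonpos (prob_nonneg _ _) ?_
    refine Real.logb_nonpos (by exact_mod_cast hq) (div_nonneg (prob_nonneg _ _) (prob_nonneg _ _)) ?_
    exact div_le_one_of_le₀ (hle s t) (prob_nonneg _ _)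
  have h0 : ∀ s t, prob μ (fun ω => (X ω, Y ω)) (s, t) *
      Real.logb q (prob μ (fun ω => (X ω, Y ω)) (s, t) / prob μ Y t) = 0 := by
    unfold condEntropy at h
    rw [neg_eq_zero, Finset.sum_eq_zero_iff_of_nonpos
      (fun s _ => Finset.sum_nonpos fun t _ => hterm s t)] at h
    intro s t
    have := h s (Finset.mem_univ _)
    rw [Finset.sum_eq_zero_iff_of_nonpos (fun t _ => hterm s t)] at this
    exact this t (Finset.mem_univ _)
  have heq : ∀ s, 0 < prob μ (fun ω => (X ω, Y ω)) (s, t) →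
      prob μ (fun ω => (X ω, Y ω)) (s, t) = prob μ Y t := by
    intro s hs
    have hY0 : 0 < prob μ Y t := hs.trans_le (hle s t)
    have h1 := (mul_eq_zero.1 (h0 s t)).resolve_left hs.ne'
    have hpos := div_pos hs hY0
    have h2 : prob μ (fun ω => (X ω, Y ω)) (s, t) / prob μ Y t = 1 :=
      Real.eq_one_of_pos_of_logb_eq_zero (by exact_mod_cast hq) hpos h1
    rwa [div_eq_one_iff_eq hY0.ne'] at h2
  by_contra hne
  have hsum := sum_prob_pair_left (μ := μ) hX hY t
  have h2 : ∑ a ∈ {s, s'}, prob μ (fun ω => (X ω, Y ω)) (a, t) ≤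
      ∑ a, prob μ (fun ω => (X ω, Y ω)) (a, t) :=
    Finset.sum_le_sum_of_subset_of_nonneg (Finset.subset_univ _) fun _ _ _ => prob_nonneg _ _
  rw [Finset.sum_pair hne, hsum, heq s hs, heq s' hs'] at h2
  have := heq s hs
  linarith

/-- Maximal entropy means relative entropy 0 with respect to the uniform law. -/
theorem prob_pos_of_entropy_eq_logb_card [Fintype S] {q : ℕ} (hq : 1 < q) {X : Ω → S}
    (hX : IsRandomVar X) (h : entropy q μ X = Real.logb q (Fintype.card S)) (s : S) :
    0 < prob μ X s := by
  have hS : (0 : ℝ) < Fintype.card S := by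
    exact_mod_cast Fintype.card_pos_iff.2 ⟨s⟩
  refine pos_of_relEntropy_nonpos hq (p := prob μ X) (r := fun _ => (Fintype.card S : ℝ)⁻¹)
    (prob_nonneg _) (fun _ => by positivity) (sum_prob hX) ?_ (fun _ _ => by positivity) ?_ s
    (by positivity)
  · simp [hS.ne']
  · have : ∀ s, prob μ X s * Real.logb q (prob μ X s / (Fintype.card S : ℝ)⁻¹) =
        prob μ X s * Real.logb q (prob μ X s) + prob μ X s * Real.logb q (Fintype.card S) := by
      intro s
      rcases (prob_nonneg (μ := μ) X s).eq_or_lt with h0 | h0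
      · rw [← h0]; simp
      · rw [div_inv_eq_mul, Real.logb_mul h0.ne' hS.ne', mul_add]
    rw [Finset.sum_congr rfl fun s _ => this s, Finset.sum_add_distrib, ← Finset.sum_mul,
      sum_prob hX, ← h]
    unfold entropy
    simp

/-- The relative entropy of the joint law with respect to the product of its marginals is H(X) +
H(Y) - H(X,Y), here 0. Of independence, only the consequence for supports is needed. -/
theorem prob_pair_pos_of_entropy_pair [Fintype S] [Fintype T] {q : ℕ} (hq : 1 < q)
    {X : Ω → S} {Y : Ω → T} (hX : IsRandomVar X) (hY : IsRandomVar Y)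
    (h : entropy q μ (fun ω => (X ω, Y ω)) = entropy q μ X + entropy q μ Y) {s : S} {t : T}
    (hs : 0 < prob μ X s) (ht : 0 < prob μ Y t) : 0 < prob μ (fun ω => (X ω, Y ω)) (s, t) := by
  have hleX : ∀ s t, prob μ (fun ω => (X ω, Y ω)) (s, t) ≤ prob μ X s := fun s t =>
    prob_mono fun ω hω => by simpa using congrArg Prod.fst hω
  have hleY : ∀ s t, prob μ (fun ω => (X ω, Y ω)) (s, t) ≤ prob μ Y t := fun s t =>
    prob_mono fun ω hω => by simpa using congrArg Prod.snd hω
  refine pos_of_relEntropy_nonpos hq (p := prob μ fun ω => (X ω, Y ω))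
    (r := fun a => prob μ X a.1 * prob μ Y a.2) (prob_nonneg _)
    (fun _ => mul_nonneg (prob_nonneg _ _) (prob_nonneg _ _)) (sum_prob (hX.prodMk hY)) ?_
    (fun a ha => mul_pos (ha.trans_le (hleX _ _)) (ha.trans_le (hleY _ _))) ?_ (s, t)
    (mul_pos hs ht)
  · rw [Fintype.sum_prod_type]
    simp only
    rw [← Finset.sum_mul_sum, sum_prob hX, sum_prob hY, one_mul]
  · have e : ∀ a : S × T, prob μ (fun ω => (X ω, Y ω)) a * Real.logb q
        (prob μ (fun ω => (X ω, Y ω)) a / (prob μ X a.1 * prob μ Y a.2)) =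
        prob μ (fun ω => (X ω, Y ω)) a * Real.logb q (prob μ (fun ω => (X ω, Y ω)) a) -
        prob μ (fun ω => (X ω, Y ω)) a * Real.logb q (prob μ X a.1) -
        prob μ (fun ω => (X ω, Y ω)) a * Real.logb q (prob μ Y a.2) := by
      rintro ⟨s, t⟩
      rcases (prob_nonneg (μ := μ) (fun ω => (X ω, Y ω)) (s, t)).eq_or_lt with h0 | h0
      · rw [← h0]; simp
      · have h1 := h0.trans_le (hleX _ _)
        have h2 := h0.trans_le (hleY _ _)
        rw [Real.logb_div h0.ne' (mul_pos h1 h2).ne', Real.logb_mul h1.ne' h2.ne']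
        ring
    rw [Finset.sum_congr rfl fun a _ => e a, Finset.sum_sub_distrib, Finset.sum_sub_distrib]
    have hx : ∑ a : S × T, prob μ (fun ω => (X ω, Y ω)) a * Real.logb q (prob μ X a.1) =
        ∑ s, prob μ X s * Real.logb q (prob μ X s) := by
      rw [Fintype.sum_prod_type]
      refine Finset.sum_congr rfl fun s _ => ?_
      dsimp only
      rw [← Finset.sum_mul, sum_prob_pair hX hY]
    have hy : ∑ a : S × T, prob μ (fun ω => (X ω, Y ω)) a * Real.logb q (prob μ Y a.2) =
        ∑ t, prob μ Y t * Real.logb q (prob μ Y t) := by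
      rw [Fintype.sum_prod_type_right]
      refine Finset.sum_congr rfl fun t _ => ?_
      dsimp only
      rw [← Finset.sum_mul, sum_prob_pair_left hX hY]
    rw [hx, hy]
    unfold entropy at h
    linarith

theorem condEntropy_eq_sub [Fintype S] [Fintype T] (q : ℕ)
    {X : Ω → S} {Y : Ω → T} (hX : IsRandomVar X) (hY : IsRandomVar Y) :
    condEntropy q μ X Y = entropy q μ (fun ω => (X ω, Y ω)) - entropy q μ Y := by
  have hleY : ∀ s t, prob μ (fun ω => (X ω, Y ω)) (s, t) ≤ prob μ Y t := fun s t =>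
    prob_mono fun ω hω => by simpa using congrArg Prod.snd hω
  have e : ∀ s t, prob μ (fun ω => (X ω, Y ω)) (s, t) * Real.logb q
        (prob μ (fun ω => (X ω, Y ω)) (s, t) / prob μ Y t) =
        prob μ (fun ω => (X ω, Y ω)) (s, t) * Real.logb q (prob μ (fun ω => (X ω, Y ω)) (s, t)) -
        prob μ (fun ω => (X ω, Y ω)) (s, t) * Real.logb q (prob μ Y t) := by
    intro s t
    rcases (prob_nonneg (μ := μ) (fun ω => (X ω, Y ω)) (s, t)).eq_or_lt with h0 | h0
    · rw [← h0]; simp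
    · rw [Real.logb_div h0.ne' (h0.trans_le (hleY _ _)).ne']
      ring
  unfold condEntropy entropy
  simp only [e, Finset.sum_sub_distrib]
  rw [Fintype.sum_prod_type]
  have hy : ∑ s, ∑ t, prob μ (fun ω => (X ω, Y ω)) (s, t) * Real.logb q (prob μ Y t) =
        ∑ t, prob μ Y t * Real.logb q (prob μ Y t) := by
    rw [Finset.sum_comm]
    refine Finset.sum_congr rfl fun t _ => ?_
    rw [← Finset.sum_mul, sum_prob_pair_left hX hY]
  rw [hy]
  ring

theorem prob_pair_pos_of_mutualInfo_eq_zero [Fintype S] [Fintype T] {q : ℕ} (hq : 1 < q)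
    {X : Ω → S} {Y : Ω → T} (hX : IsRandomVar X) (hY : IsRandomVar Y)
    (h : mutualInfo q μ X Y = 0) {s : S} {t : T}
    (hs : 0 < prob μ X s) (ht : 0 < prob μ Y t) : 0 < prob μ (fun ω => (X ω, Y ω)) (s, t) := by
  refine prob_pair_pos_of_entropy_pair hq hX hY ?_ hs ht
  unfold mutualInfo at h
  rw [condEntropy_eq_sub q hX hY] at h
  linarith

/-- The comparison law is P(s,u) P(t,u) / P(u), under which X and Y are conditionally independent
given V. -/
theorem prob_triple_pos_of_condMutualInfo_eq_zero [Fintype S] [Fintype T] [Fintype U] {q : ℕ}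
    (hq : 1 < q) {X : Ω → S} {Y : Ω → T} {V : Ω → U}
    (hX : IsRandomVar X) (hY : IsRandomVar Y) (hV : IsRandomVar V)
    (h : condMutualInfo q μ X Y V = 0) {s : S} {t : T} {u : U}
    (hs : 0 < prob μ (fun ω => (X ω, V ω)) (s, u))
    (ht : 0 < prob μ (fun ω => (Y ω, V ω)) (t, u)) :
    0 < prob μ (fun ω => (X ω, Y ω, V ω)) (s, t, u) := by
  have hYV := hY.prodMk hV
  have hleXV : ∀ s t u, prob μ (fun ω => (X ω, Y ω, V ω)) (s, t, u) ≤
      prob μ (fun ω => (X ω, V ω)) (s, u) := fun s t u =>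
    prob_mono fun ω hω => by simp only [Prod.mk.injEq] at hω ⊢; tauto
  have hleYV : ∀ s t u, prob μ (fun ω => (X ω, Y ω, V ω)) (s, t, u) ≤
      prob μ (fun ω => (Y ω, V ω)) (t, u) := fun s t u =>
    prob_mono fun ω hω => by simp only [Prod.mk.injEq] at hω ⊢; tauto
  have hleV : ∀ t u, prob μ (fun ω => (Y ω, V ω)) (t, u) ≤ prob μ V u := fun t u =>
    prob_mono fun ω hω => by simp only [Prod.mk.injEq] at hω; tauto
  have hmarg : ∀ s u, ∑ t, prob μ (fun ω => (X ω, Y ω, V ω)) (s, t, u) =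
      prob μ (fun ω => (X ω, V ω)) (s, u) := by
    intro s u
    rw [← sum_prob_pair (hX.prodMk hV) hY]
    exact Finset.sum_congr rfl fun t _ => prob_congr fun ω => by
      simp only [Prod.mk.injEq]; tauto
  refine pos_of_relEntropy_nonpos hq (p := prob μ fun ω => (X ω, Y ω, V ω))
    (r := fun a => prob μ (fun ω => (X ω, V ω)) (a.1, a.2.2) *
      prob μ (fun ω => (Y ω, V ω)) a.2 / prob μ V a.2.2) (prob_nonneg _)
    (fun _ => div_nonneg (mul_nonneg (prob_nonneg _ _) (prob_nonneg _ _)) (prob_nonneg _ _))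
    (sum_prob (hX.prodMk hYV)) ?_
    (fun a ha => div_pos (mul_pos (ha.trans_le (hleXV _ _ _)) (ha.trans_le (hleYV _ _ _)))
      ((ha.trans_le (hleYV _ _ _)).trans_le (hleV _ _))) ?_ (s, t, u)
    (div_pos (mul_pos hs ht) (ht.trans_le (hleV _ _)))
  · have hu : ∀ u, ∑ s, ∑ t, prob μ (fun ω => (X ω, V ω)) (s, u) *
        prob μ (fun ω => (Y ω, V ω)) (t, u) / prob μ V u = prob μ V u := by
      intro u
      simp only [← Finset.sum_div]
      rw [← Finset.sum_mul_sum, sum_prob_pair_left hX hV, sum_prob_pair_left hY hV]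
      -- The convention x / 0 = 0 makes this valid also when P(u) = 0.
      exact mul_self_div_self _
    rw [Fintype.sum_prod_type]
    simp only [Fintype.sum_prod_type_right]
    rw [Finset.sum_comm]
    simp only [hu, sum_prob hV, le_refl]
  · have e : ∀ a : S × T × U, prob μ (fun ω => (X ω, Y ω, V ω)) a * Real.logb q
        (prob μ (fun ω => (X ω, Y ω, V ω)) a / (prob μ (fun ω => (X ω, V ω)) (a.1, a.2.2) *
      prob μ (fun ω => (Y ω, V ω)) a.2 / prob μ V a.2.2)) =
        prob μ (fun ω => (X ω, Y ω, V ω)) a * Real.logb q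
          (prob μ (fun ω => (X ω, Y ω, V ω)) a / prob μ (fun ω => (Y ω, V ω)) a.2) -
        prob μ (fun ω => (X ω, Y ω, V ω)) a * Real.logb q
          (prob μ (fun ω => (X ω, V ω)) (a.1, a.2.2) / prob μ V a.2.2) := by
      rintro ⟨s, t, u⟩
      rcases (prob_nonneg (μ := μ) (fun ω => (X ω, Y ω, V ω)) (s, t, u)).eq_or_lt with h0 | h0
      · rw [← h0]; simp
      · have h1 := h0.trans_le (hleXV _ _ _)
        have h2 := h0.trans_le (hleYV _ _ _)
        have h3 := h2.trans_le (hleV _ _)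
        rw [← mul_sub, ← Real.logb_div (div_pos h0 h2).ne' (div_pos h1 h3).ne']
        congr 2
        simp only
        field_simp
    rw [Finset.sum_congr rfl fun a _ => e a, Finset.sum_sub_distrib]
    have hx : ∑ a : S × T × U, prob μ (fun ω => (X ω, Y ω, V ω)) a * Real.logb q
          (prob μ (fun ω => (X ω, V ω)) (a.1, a.2.2) / prob μ V a.2.2) =
        ∑ s, ∑ u, prob μ (fun ω => (X ω, V ω)) (s, u) * Real.logb q
          (prob μ (fun ω => (X ω, V ω)) (s, u) / prob μ V u) := by
      rw [Fintype.sum_prod_type]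
      refine Finset.sum_congr rfl fun s _ => ?_
      rw [Fintype.sum_prod_type_right]
      refine Finset.sum_congr rfl fun u _ => ?_
      dsimp only
      rw [← Finset.sum_mul, hmarg]
    rw [hx, Fintype.sum_prod_type]
    unfold condMutualInfo condEntropy at h
    linarith

/-- The mass of `t` is a finite sum over values of `X`, so some value in its preimage under `f` has
positive mass and is attained. This turns positive probabilities into actual sample points. -/
theorem exists_prob_pos_of_comp [Fintype S] {X : Ω → S} (hX : IsRandomVar X) {f : S → T} {t : T}
    (h : 0 < prob μ (fun ω => f (X ω)) t) : ∃ ω, 0 < prob μ X (X ω) ∧ f (X ω) = t := by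
  classical
  by_contra! hcon
  have h2 := sum_prob_pair_left (μ := μ) hX (hX.comp f) t
  rw [← h2] at h
  obtain ⟨s, -, hs⟩ := Finset.exists_lt_of_sum_lt (s := Finset.univ) (f := fun _ => (0 : ℝ))
    (by simpa using h)
  have hne : ((fun ω => (X ω, f (X ω))) ⁻¹' {(s, t)}).Nonempty := by
    by_contra hemp
    rw [Set.not_nonempty_iff_eq_empty] at hemp
    unfold prob at hs
    rw [hemp] at hs
    simp at hs
  obtain ⟨ω, hω⟩ := hne
  simp only [Set.mem_preimage, Set.mem_singleton_iff, Prod.mk.injEq] at hω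
  refine hcon ω ?_ hω.2
  rw [hω.1]
  exact hs.trans_le (prob_mono fun ω' h' => by simpa using congrArg Prod.fst h')

end Support

-- The constraints of a scheme at good sample points

attribute [instance] Scheme.measurableSpace Scheme.isProbabilityMeasure

namespace Scheme

variable {K B : ℕ} {F : Type} [Field F] [Fintype F] (s : Scheme K B F)

/-- All the random variables of a scheme, jointly. -/
def total (ω : s.Ω) : (Fin K → Fin s.L → F) × (Fin K → Fin s.LZ → F) × (Fin s.LS → F) ×
    ((k i : Fin K) → Fin (s.LX k i) → F) × ((i : Fin K) → Fin (s.LY i) → F) :=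
  (fun k => s.W k ω, fun k => s.Z k ω, s.S ω, fun k i => s.X k i ω, fun i => s.Y i ω)

theorem total_rv : IsRandomVar s.total :=
  (IsRandomVar.pi s.W_rv).prodMk <| (IsRandomVar.pi s.Z_rv).prodMk <| s.S_rv.prodMk <|
    (IsRandomVar.pi fun k => IsRandomVar.pi (s.X_rv k)).prodMk (IsRandomVar.pi s.Y_rv)

/-- The sample points whose joint outcome has positive probability. -/
def good : Set s.Ω := {ω | 0 < prob s.μ s.total (s.total ω)}

theorem prob_pos_of_good {T : Type} {R : s.Ω → T} {ω : s.Ω} (hω : ω ∈ s.good)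
    (h : ∀ ω', s.total ω' = s.total ω → R ω' = R ω) : 0 < prob s.μ R (R ω) :=
  lt_of_lt_of_le hω (prob_mono h)

theorem exists_good {T : Type} (f : _ → T) {t : T}
    (h : 0 < prob s.μ (fun ω => f (s.total ω)) t) : ∃ ω ∈ s.good, f (s.total ω) = t :=
  exists_prob_pos_of_comp s.total_rv h

theorem good_nonempty : s.good.Nonempty := by
  obtain ⟨ω, hω, -⟩ := s.exists_good (fun _ => ()) (t := ()) (by
    have := sum_prob (μ := s.μ) (X := fun _ : s.Ω => ()) (fun _ => MeasurableSet.const _)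
    simp at this
    rw [this]
    exact one_pos)
  exact ⟨ω, hω⟩

theorem Z_eq_of_S_eq {ω ω' : s.Ω} (h : ω ∈ s.good) (h' : ω' ∈ s.good) (hS : s.S ω = s.S ω')
    (k : Fin K) : s.Z k ω = s.Z k ω' := by
  have h1 := s.prob_pos_of_good (R := fun ω => ((fun k => s.Z k ω), s.S ω)) h
    (fun ω' e => by simp only [total, Prod.mk.injEq] at e ⊢; tauto)
  have h2 := s.prob_pos_of_good (R := fun ω => ((fun k => s.Z k ω), s.S ω)) h'
    (fun ω' e => by simp only [total, Prod.mk.injEq] at e ⊢; tauto)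
  simp only [hS] at h1
  exact congrFun (eq_of_condEntropy_eq_zero Fintype.one_lt_card (IsRandomVar.pi s.Z_rv) s.S_rv
    s.key_gen h1 h2) k

theorem X_eq_of_eq {ω ω' : s.Ω} (h : ω ∈ s.good) (h' : ω' ∈ s.good) {k : Fin K}
    (hW : s.W k ω = s.W k ω') (hZ : s.Z k ω = s.Z k ω') {i : Fin K} (hi : i ∈ relaysOf K B k) :
    s.X k i ω = s.X k i ω' := by
  have aux : ∀ ω ∈ s.good, 0 < prob s.μ (fun ω => ((fun (i : {i // i ∈ relaysOf K B k}) =>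
      s.X k i ω), (s.W k ω, s.Z k ω))) ((fun (i : {i // i ∈ relaysOf K B k}) => s.X k i ω),
        (s.W k ω, s.Z k ω)) := fun ω hω => s.prob_pos_of_good hω fun ω' e => by
    simp only [total, Prod.mk.injEq, funext_iff] at e ⊢
    simp [e]
  have h1 := aux ω h
  have h2 := aux ω' h'
  simp only [hW, hZ] at h1
  exact congrFun (eq_of_condEntropy_eq_zero Fintype.one_lt_card (IsRandomVar.pi fun i : {i // i ∈ relaysOf K B k} => s.X_rv k i)
    ((s.W_rv k).prodMk (s.Z_rv k)) (s.user_encode k) h1 h2) ⟨i, hi⟩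

theorem Y_eq_of_eq {ω ω' : s.Ω} (h : ω ∈ s.good) (h' : ω' ∈ s.good) {i : Fin K}
    (hX : ∀ k ∈ usersOf K B i, s.X k i ω = s.X k i ω') : s.Y i ω = s.Y i ω' := by
  have aux : ∀ ω ∈ s.good, 0 < prob s.μ (fun ω => (s.Y i ω,
      (fun (k : {k // k ∈ usersOf K B i}) => s.X k i ω))) (s.Y i ω,
      (fun (k : {k // k ∈ usersOf K B i}) => s.X k i ω)) :=
    fun ω hω => s.prob_pos_of_good hω fun ω' e => by
      simp only [total, Prod.mk.injEq, funext_iff] at e ⊢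
      simp [e]
  have h1 := aux ω h
  have h2 := aux ω' h'
  have e : (fun (k : {k // k ∈ usersOf K B i}) => s.X k i ω) =
      fun k : {k // k ∈ usersOf K B i} => s.X k i ω' :=
    funext fun k => hX k k.2
  rw [e] at h1
  exact eq_of_condEntropy_eq_zero Fintype.one_lt_card (s.Y_rv i) (IsRandomVar.pi fun k : {k // k ∈ usersOf K B i} => s.X_rv k i)
    (s.relay_encode i) h1 h2

theorem sum_W_eq_of_Y_eq {ω ω' : s.Ω} (h : ω ∈ s.good) (h' : ω' ∈ s.good)
    (hY : ∀ i, s.Y i ω = s.Y i ω') : ∑ k, s.W k ω = ∑ k, s.W k ω' := by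
  have aux : ∀ ω ∈ s.good, 0 < prob s.μ (fun ω => (∑ k, s.W k ω, fun i => s.Y i ω))
      (∑ k, s.W k ω, fun i => s.Y i ω) :=
    fun ω hω => s.prob_pos_of_good hω fun ω' e => by
      simp only [total, Prod.mk.injEq, funext_iff] at e ⊢
      refine ⟨fun x => ?_, e.2.2.2.2⟩
      simp [e]
  have h1 := aux ω h
  have h2 := aux ω' h'
  rw [show (fun i => s.Y i ω) = fun i => s.Y i ω' from funext hY] at h1
  exact eq_of_condEntropy_eq_zero Fintype.one_lt_card
    ((IsRandomVar.pi s.W_rv).comp fun w => ∑ k, w k) (IsRandomVar.pi s.Y_rv) s.recovery h1 h2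

/-- The joint entropy KL is the logarithm of the alphabet size, so no input tuple can be missing
from the support. -/
theorem W_full (w : Fin K → Fin s.L → F) : 0 < prob s.μ (fun ω k => s.W k ω) w := by
  refine prob_pos_of_entropy_eq_logb_card (Fintype.one_lt_card (α := F)) (IsRandomVar.pi s.W_rv) ?_ w
  have hq : (1 : ℝ) < Fintype.card F := by exact_mod_cast Fintype.one_lt_card (α := F)
  rw [s.input_indep]
  simp only [s.input_uniform, Fintype.card_pi, Finset.prod_const, Finset.card_univ,
    Fintype.card_fin, Nat.cast_pow, Real.logb_pow, Finset.sum_const, nsmul_eq_mul]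
  rw [Real.logb_self_eq_one hq, mul_one]

/-- Independence of keys and inputs: the inputs can be replaced while the keys stay frozen. -/
theorem exists_good_W_Z (w : Fin K → Fin s.L → F) {ω : s.Ω} (h : ω ∈ s.good) :
    ∃ ω' ∈ s.good, (∀ k, s.W k ω' = w k) ∧ ∀ k, s.Z k ω' = s.Z k ω := by
  have h1 := s.prob_pos_of_good (R := fun ω k => s.Z k ω) h
    (fun ω' e => by simp only [total, Prod.mk.injEq] at e ⊢; tauto)
  have h2 := s.key_input_indep
  rw [← s.input_indep] at h2
  obtain ⟨ω', hg, e⟩ := s.exists_good (fun a => (a.1, a.2.1)) (prob_pair_pos_of_entropy_pair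
    Fintype.one_lt_card (IsRandomVar.pi s.W_rv) (IsRandomVar.pi s.Z_rv) h2 (s.W_full w) h1)
  simp only [total, Prod.mk.injEq, funext_iff] at e
  exact ⟨ω', hg, fun k => funext (e.1 k), fun k => funext (e.2 k)⟩

/-- Relay security: what one relay sees is compatible with every input tuple. The keys may change in
the process. -/
theorem exists_good_W_X (w : Fin K → Fin s.L → F) {ω : s.Ω} (h : ω ∈ s.good) (i : Fin K) :
    ∃ ω' ∈ s.good, (∀ k, s.W k ω' = w k) ∧ ∀ k ∈ usersOf K B i, s.X k i ω' = s.X k i ω := by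
  have h1 := s.prob_pos_of_good (R := fun ω (k : {k // k ∈ usersOf K B i}) => s.X k i ω) h
    (fun ω' e => by
      simp only [total, Prod.mk.injEq, funext_iff] at e ⊢
      simp [e])
  obtain ⟨ω', hg, e⟩ := s.exists_good
    (fun a => ((fun k : {k // k ∈ usersOf K B i} => a.2.2.2.1 k i), a.1))
    (prob_pair_pos_of_mutualInfo_eq_zero Fintype.one_lt_card (IsRandomVar.pi fun k : {k // k ∈ usersOf K B i} => s.X_rv k i)
      (IsRandomVar.pi s.W_rv) (s.relay_security i) h1 (s.W_full w))
  simp only [total, Prod.mk.injEq, funext_iff] at e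
  exact ⟨ω', hg, fun k => funext (e.2 k), fun k hk => funext (e.1 ⟨k, hk⟩)⟩

/-- Server security: what the server sees is compatible with every input tuple of the same sum. -/
theorem exists_good_W_Y (w : Fin K → Fin s.L → F) {ω : s.Ω} (h : ω ∈ s.good)
    (hw : ∑ k, s.W k ω = ∑ k, w k) :
    ∃ ω' ∈ s.good, (∀ k, s.W k ω' = w k) ∧ ∀ i, s.Y i ω' = s.Y i ω := by
  have h1 := s.prob_pos_of_good (R := fun ω => ((fun i => s.Y i ω), ∑ k, s.W k ω)) h
    (fun ω' e => by
      simp only [total, Prod.mk.injEq, funext_iff] at e ⊢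
      refine ⟨e.2.2.2.2, fun x => ?_⟩
      simp [e])
  have h2 : 0 < prob s.μ (fun ω => ((fun k => s.W k ω), ∑ k, s.W k ω)) (w, ∑ k, s.W k ω) := by
    rw [hw]
    refine (s.W_full w).trans_le (prob_mono fun ω e => ?_)
    rw [← e]
  obtain ⟨ω', hg, e⟩ := s.exists_good
    (fun a => ((fun i => a.2.2.2.2 i), (fun k => a.1 k), ∑ k, a.1 k))
    (prob_triple_pos_of_condMutualInfo_eq_zero Fintype.one_lt_card (IsRandomVar.pi s.Y_rv)
      (IsRandomVar.pi s.W_rv) ((IsRandomVar.pi s.W_rv).comp fun w => ∑ k, w k)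
      s.server_security h1 h2)
  simp only [total, Prod.mk.injEq, funext_iff] at e
  exact ⟨ω', hg, fun k => funext (e.2.1 k), fun i => funext (e.1 i)⟩

end Scheme

/-! ### A Shearer-type inequality for the uniform distribution -/

section Shearer

open scoped Classical in
/-- The number of points on which `X` takes the same value as at `ω`. -/
noncomputable def fiberCard {Ω S : Type} [Fintype Ω] (X : Ω → S) (ω : Ω) : ℕ :=
  (Finset.univ.filter fun ω' => X ω' = X ω).card

variable {Ω S T U : Type} [Fintype Ω]

theorem fiberCard_pos (X : Ω → S) (ω : Ω) : 0 < fiberCard X ω :=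
  Finset.card_pos.2 ⟨ω, by simp⟩

theorem fiberCard_congr {X : Ω → S} {Y : Ω → T} (h : ∀ ω ω', X ω' = X ω ↔ Y ω' = Y ω) (ω : Ω) :
    fiberCard X ω = fiberCard Y ω := by
  unfold fiberCard
  congr 1
  ext ω'
  simp [h ω ω']

/-- The sum of `log (fiberCard X)`; up to an affine change, minus the entropy of `X` for the
uniform distribution. -/
noncomputable def logFiberSum (X : Ω → S) : ℝ := ∑ ω, Real.log (fiberCard X ω)

theorem logFiberSum_congr {X : Ω → S} {Y : Ω → T} (h : ∀ ω ω', X ω' = X ω ↔ Y ω' = Y ω) :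
    logFiberSum X = logFiberSum Y := by
  unfold logFiberSum
  simp only [fiberCard_congr h]

/-- The numerator counts pairs (a, b) with a in the (X,Z)-fibre and b in the (Y,Z)-fibre of ω.
Summed over ω first, each a contributes at most 1. -/
theorem sum_fiberCard_ratio_le (X : Ω → S) (Y : Ω → T) (Z : Ω → U) :
    ∑ ω, ((fiberCard (fun ω => (X ω, Z ω)) ω : ℝ) * fiberCard (fun ω => (Y ω, Z ω)) ω /
      (fiberCard (fun ω => (X ω, Y ω, Z ω)) ω * fiberCard Z ω)) ≤ Fintype.card Ω := by
  classical
  have h1 : ∀ ω, ((fiberCard (fun ω => (X ω, Z ω)) ω : ℝ) * fiberCard (fun ω => (Y ω, Z ω)) ω /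
      (fiberCard (fun ω => (X ω, Y ω, Z ω)) ω * fiberCard Z ω)) =
      ∑ a, ∑ b, if X a = X ω ∧ Z a = Z ω ∧ Y b = Y ω ∧ Z b = Z ω then
        ((fiberCard (fun ω => (X ω, Y ω, Z ω)) ω : ℝ) * fiberCard Z ω)⁻¹ else 0 := by
    intro ω
    rw [div_eq_mul_inv]
    have e1 : (fiberCard (fun ω => (X ω, Z ω)) ω : ℝ) =
        ∑ a, if X a = X ω ∧ Z a = Z ω then 1 else 0 := by
      simp [fiberCard]
    have e2 : (fiberCard (fun ω => (Y ω, Z ω)) ω : ℝ) =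
        ∑ a, if Y a = Y ω ∧ Z a = Z ω then 1 else 0 := by
      simp [fiberCard]
    rw [e1, e2, Finset.sum_mul_sum, Finset.sum_mul]
    refine Finset.sum_congr rfl fun a _ => ?_
    rw [Finset.sum_mul]
    refine Finset.sum_congr rfl fun b _ => ?_
    by_cases h1 : X a = X ω ∧ Z a = Z ω <;> by_cases h2 : Y b = Y ω ∧ Z b = Z ω
    · rw [if_pos h1, if_pos h2, if_pos ⟨h1.1, h1.2, h2⟩]; ring
    · rw [if_neg h2, if_neg (show ¬(X a = X ω ∧ Z a = Z ω ∧ Y b = Y ω ∧ Z b = Z ω) from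
        fun h => h2 h.2.2)]; ring
    · rw [if_neg h1, if_neg (show ¬(X a = X ω ∧ Z a = Z ω ∧ Y b = Y ω ∧ Z b = Z ω) from
        fun h => h1 ⟨h.1, h.2.1⟩)]; ring
    · rw [if_neg h1, if_neg (show ¬(X a = X ω ∧ Z a = Z ω ∧ Y b = Y ω ∧ Z b = Z ω) from
        fun h => h1 ⟨h.1, h.2.1⟩)]; ring
  rw [Finset.sum_congr rfl fun ω _ => h1 ω, Finset.sum_comm]
  have h2 : ∀ a, ∑ ω, ∑ b, (if X a = X ω ∧ Z a = Z ω ∧ Y b = Y ω ∧ Z b = Z ω then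
        ((fiberCard (fun ω => (X ω, Y ω, Z ω)) ω : ℝ) * fiberCard Z ω)⁻¹ else 0) ≤ 1 := by
    intro a
    rw [Finset.sum_comm]
    -- For fixed a, b the admissible ω are either none or one whole (X,Y,Z)-fibre. Its size cancels
    -- the first factor of the weight, leaving the inverse size of the Z-fibre of a.
    have h3 : ∀ b, ∑ ω, (if X a = X ω ∧ Z a = Z ω ∧ Y b = Y ω ∧ Z b = Z ω then
        ((fiberCard (fun ω => (X ω, Y ω, Z ω)) ω : ℝ) * fiberCard Z ω)⁻¹ else 0) ≤
        if Z b = Z a then (fiberCard Z a : ℝ)⁻¹ else 0 := by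
      intro b
      rw [← Finset.sum_filter]
      rcases (Finset.univ.filter fun ω =>
        X a = X ω ∧ Z a = Z ω ∧ Y b = Y ω ∧ Z b = Z ω).eq_empty_or_nonempty with he | ⟨c, hc⟩
      · rw [he, Finset.sum_empty]
        split_ifs <;> positivity
      · simp only [Finset.mem_filter, Finset.mem_univ, true_and] at hc
        obtain ⟨c1, c2, c3, c4⟩ := hc
        rw [if_pos (c4.trans c2.symm)]
        have hset : (Finset.univ.filter fun ω =>
            X a = X ω ∧ Z a = Z ω ∧ Y b = Y ω ∧ Z b = Z ω) =
            Finset.univ.filter fun ω => (X ω, Y ω, Z ω) = (X c, Y c, Z c) := by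
          ext ω
          simp only [Finset.mem_filter, Finset.mem_univ, true_and, Prod.mk.injEq]
          rw [c1, c2, c3, c4]
          constructor
          · rintro ⟨h1, h2, h3, h4⟩; exact ⟨h1.symm, h3.symm, h4.symm⟩
          · rintro ⟨h1, h2, h3⟩; exact ⟨h1.symm, h3.symm, h2.symm, h3.symm⟩
        have hval : ∀ ω ∈ Finset.univ.filter fun ω => (X ω, Y ω, Z ω) = (X c, Y c, Z c),
            ((fiberCard (fun ω => (X ω, Y ω, Z ω)) ω : ℝ) * fiberCard Z ω)⁻¹ =
            ((fiberCard (fun ω => (X ω, Y ω, Z ω)) c : ℝ) * fiberCard Z a)⁻¹ := by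
          intro ω hω
          simp only [Finset.mem_filter, Finset.mem_univ, true_and] at hω
          have e1 : fiberCard (fun ω => (X ω, Y ω, Z ω)) ω =
              fiberCard (fun ω => (X ω, Y ω, Z ω)) c := by
            unfold fiberCard; simp only [hω]
          have e2 : fiberCard Z ω = fiberCard Z a := by
            unfold fiberCard
            rw [show Z ω = Z a from (congrArg (fun p => p.2.2) hω).trans c2.symm]
          rw [e1, e2]
        rw [hset, Finset.sum_congr rfl hval, Finset.sum_const, nsmul_eq_mul]
        have hcard : (Finset.univ.filter fun ω => (X ω, Y ω, Z ω) = (X c, Y c, Z c)).card =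
            fiberCard (fun ω => (X ω, Y ω, Z ω)) c := by
          unfold fiberCard; congr
        rw [hcard]
        have hp : (0 : ℝ) < fiberCard (fun ω => (X ω, Y ω, Z ω)) c := by
          exact_mod_cast fiberCard_pos _ _
        rw [mul_inv, mul_inv_cancel_left₀ hp.ne']
    refine (Finset.sum_le_sum fun b _ => h3 b).trans ?_
    rw [← Finset.sum_filter, Finset.sum_const, nsmul_eq_mul]
    have hcard : (Finset.univ.filter fun b => Z b = Z a).card = fiberCard Z a := by
      unfold fiberCard; congr
    rw [hcard]
    exact mul_inv_le_one
  refine (Finset.sum_le_sum fun a _ => ?_).trans_eq (b := ∑ a : Ω, (1 : ℝ)) (by simp)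
  exact h2 a

/-- Submodularity of entropy for the uniform distribution. -/
theorem logFiberSum_submodular (X : Ω → S) (Y : Ω → T) (Z : Ω → U) :
    logFiberSum (fun ω => (X ω, Z ω)) + logFiberSum (fun ω => (Y ω, Z ω)) ≤
      logFiberSum (fun ω => (X ω, Y ω, Z ω)) + logFiberSum Z := by
  have hp : ∀ {V : Type} (R : Ω → V) ω, (0 : ℝ) < fiberCard R ω := fun R ω => by
    exact_mod_cast fiberCard_pos R ω
  have h := Finset.sum_le_sum fun ω (_ : ω ∈ Finset.univ) => Real.log_le_sub_one_of_pos
    (div_pos (mul_pos (hp (fun ω => (X ω, Z ω)) ω) (hp (fun ω => (Y ω, Z ω)) ω))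
      (mul_pos (hp (fun ω => (X ω, Y ω, Z ω)) ω) (hp Z ω)))
  rw [Finset.sum_sub_distrib] at h
  have h2 := sum_fiberCard_ratio_le X Y Z
  have h3 : ∀ ω, Real.log ((fiberCard (fun ω => (X ω, Z ω)) ω : ℝ) *
      fiberCard (fun ω => (Y ω, Z ω)) ω /
      (fiberCard (fun ω => (X ω, Y ω, Z ω)) ω * fiberCard Z ω)) =
      Real.log (fiberCard (fun ω => (X ω, Z ω)) ω) + Real.log (fiberCard (fun ω => (Y ω, Z ω)) ω)
      - (Real.log (fiberCard (fun ω => (X ω, Y ω, Z ω)) ω) + Real.log (fiberCard Z ω)) := by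
    intro ω
    rw [Real.log_div (mul_pos (hp _ ω) (hp _ ω)).ne' (mul_pos (hp _ ω) (hp _ ω)).ne',
      Real.log_mul (hp _ ω).ne' (hp _ ω).ne', Real.log_mul (hp _ ω).ne' (hp _ ω).ne']
  simp only [h3, Finset.sum_sub_distrib, Finset.sum_add_distrib] at h
  simp only [Finset.sum_const, Finset.card_univ, nsmul_eq_mul, mul_one] at h
  unfold logFiberSum
  linarith

-- Entropy is at most the logarithm of the number of values: log x ≤ x - 1 is applied to |Ω| /
-- (fibre size · number of values), and these ratios sum to |Ω|.
open scoped Classical in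
theorem card_mul_log_card_le (X : Ω → S) : Fintype.card Ω * Real.log (Fintype.card Ω) ≤
    logFiberSum X + Fintype.card Ω * Real.log (Finset.univ.image X).card := by
  rcases isEmpty_or_nonempty Ω with hΩ | hΩ
  · simp [logFiberSum]
  have hp : ∀ ω, (0 : ℝ) < fiberCard X ω := fun ω => by exact_mod_cast fiberCard_pos X ω
  have hN : (0 : ℝ) < Fintype.card Ω := by exact_mod_cast Fintype.card_pos
  have hM : (0 : ℝ) < (Finset.univ.image X).card := by
    exact_mod_cast Finset.card_pos.2 (Finset.univ_nonempty.image X)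
  have h := Finset.sum_le_sum fun ω (_ : ω ∈ Finset.univ) => Real.log_le_sub_one_of_pos
    (div_pos hN (mul_pos (hp ω) hM))
  have h3 : ∀ ω, Real.log ((Fintype.card Ω : ℝ) / (fiberCard X ω * (Finset.univ.image X).card)) =
      Real.log (Fintype.card Ω) - (Real.log (fiberCard X ω) +
        Real.log (Finset.univ.image X).card) := by
    intro ω
    rw [Real.log_div hN.ne' (mul_pos (hp ω) hM).ne', Real.log_mul (hp ω).ne' hM.ne']
  have h4 : ∑ ω, (Fintype.card Ω : ℝ) / (fiberCard X ω * (Finset.univ.image X).card) =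
      Fintype.card Ω := by
    have e := Finset.sum_comp (s := (Finset.univ : Finset Ω))
      (fun y => ((Finset.univ.filter fun ω => X ω = y).card : ℝ)⁻¹) X
    have e2 : ∀ y ∈ Finset.univ.image X, (Finset.univ.filter fun ω => X ω = y).card •
        ((Finset.univ.filter fun ω => X ω = y).card : ℝ)⁻¹ = 1 := by
      intro y hy
      rw [nsmul_eq_mul]
      refine mul_inv_cancel₀ ?_
      obtain ⟨ω, -, rfl⟩ := Finset.mem_image.1 hy
      exact_mod_cast (Finset.card_pos.2 ⟨ω, by simp⟩).ne'
    rw [Finset.sum_congr rfl e2, Finset.sum_const, nsmul_eq_mul, mul_one] at e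
    have e3 : ∀ ω, (Fintype.card Ω : ℝ) / (fiberCard X ω * (Finset.univ.image X).card) =
        Fintype.card Ω / (Finset.univ.image X).card *
          ((Finset.univ.filter fun ω' => X ω' = X ω).card : ℝ)⁻¹ := by
      intro ω
      unfold fiberCard
      rw [div_eq_mul_inv, mul_inv]; ring
    rw [Finset.sum_congr rfl fun ω _ => e3 ω, ← Finset.mul_sum, e]
    field_simp
  rw [Finset.sum_sub_distrib, h4] at h
  simp only [h3, Finset.sum_sub_distrib, Finset.sum_add_distrib] at h
  simp only [Finset.sum_const, Finset.card_univ, nsmul_eq_mul, mul_one] at h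
  unfold logFiberSum
  linarith

theorem logFiberSum_le_of_imp {X : Ω → S} {Y : Ω → T} (h : ∀ ω ω', X ω' = X ω → Y ω' = Y ω) :
    logFiberSum X ≤ logFiberSum Y := by
  refine Finset.sum_le_sum fun ω _ => Real.log_le_log (by exact_mod_cast fiberCard_pos X ω) ?_
  unfold fiberCard
  exact_mod_cast Finset.card_le_card fun ω' => by simpa using h ω ω'

/-- A Shearer-type bound: if each coordinate of `w` can be recovered from the outputs and the
other coordinates, and every output depends on at most `B` coordinates, then the outputs take at
least `|A| ^ (K / B)` values. -/
theorem card_pow_le_card_image_pow {K B : ℕ} {A : Type} [Fintype A] [Nonempty A]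
    {Q : Fin K → Type} (f : (i : Fin K) → (Fin K → A) → Q i) (N : Fin K → Finset (Fin K))
    (hN : ∀ i, (N i).card ≤ B)
    (hf : ∀ i w w', (∀ k ∈ N i, w k = w' k) → f i w = f i w')
    (hinj : ∀ k w w', (∀ j, j ≠ k → w j = w' j) → (∀ i, f i w = f i w') → w = w') :
    Fintype.card A ^ K ≤ (Set.range fun w i => f i w).ncard ^ B := by
  classical
  rw [← Set.image_univ, ← Finset.coe_univ, ← Finset.coe_image, Set.ncard_coe_finset]
  -- The first j outputs; `none` fills the rest so that all prefixes have one type.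
  let pre : ℕ → (Fin K → A) → ((i : Fin K) → Option (Q i)) := fun j w i =>
    if i.val < j then some (f i w) else none
  have hpre : ∀ j w w', pre j w' = pre j w ↔ ∀ i : Fin K, i.val < j → f i w' = f i w := by
    intro j w w'
    simp only [pre, funext_iff]
    refine forall_congr' fun i => ?_
    by_cases h : i.val < j <;> simp [h]
  let rest : (k : Fin K) → (Fin K → A) → ({j // j ≠ k} → A) := fun k w j => w j
  have hrest : ∀ k w w', rest k w' = rest k w ↔ ∀ j, j ≠ k → w' j = w j := by
    intro k w w'
    simp [rest, funext_iff]
  let E : ℕ → ℝ := fun j => logFiberSum (pre j)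
  let G : Fin K → ℕ → ℝ := fun k j => logFiberSum fun w => (rest k w, pre j w)
  -- Up to the factor |Ω|, the left side is H(f_j | f_{<j}, w without w_k) and E j - E (j+1) is
  -- H(f_j | f_{<j}). Conditioning lowers entropy, and the left side is 0 when f_j does not read
  -- w_k.
  have hG : ∀ k, ∀ j : Fin K, G k j - G k (j + 1) ≤
      if k ∈ N j then E j - E (j + 1) else 0 := by
    intro k j
    split_ifs with hk
    · have h := logFiberSum_submodular (f j) (rest k) (pre j)
      have e1 : logFiberSum (fun w => (f j w, pre j w)) = E (j + 1) := by
        refine logFiberSum_congr fun w w' => ?_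
        simp only [Prod.mk.injEq, hpre]
        constructor
        · rintro ⟨h1, h2⟩ i hi
          rcases Nat.lt_succ_iff_lt_or_eq.1 hi with h | h
          · exact h2 i h
          · rw [Fin.ext h]; exact h1
        · exact fun h => ⟨h j (Nat.lt_succ_self _), fun i hi => h i (hi.trans (Nat.lt_succ_self _))⟩
      have e2 : logFiberSum (fun w => (f j w, rest k w, pre j w)) = G k (j + 1) := by
        refine logFiberSum_congr fun w w' => ?_
        simp only [Prod.mk.injEq, hpre]
        constructor
        · rintro ⟨h1, h3, h2⟩
          refine ⟨h3, fun i hi => ?_⟩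
          rcases Nat.lt_succ_iff_lt_or_eq.1 hi with h | h
          · exact h2 i h
          · rw [Fin.ext h]; exact h1
        · exact fun h => ⟨h.2 j (Nat.lt_succ_self _), h.1,
            fun i hi => h.2 i (hi.trans (Nat.lt_succ_self _))⟩
      rw [e1, e2] at h
      change E (j + 1) + G k j ≤ G k (j + 1) + E j at h
      linarith
    · have : G k j = G k (j + 1) := by
        refine logFiberSum_congr fun w w' => ?_
        simp only [Prod.mk.injEq, hpre, hrest]
        refine and_congr_right fun h3 => ⟨fun h2 i hi => ?_, fun h i hi =>
          h i (hi.trans (Nat.lt_succ_self _))⟩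
        rcases Nat.lt_succ_iff_lt_or_eq.1 hi with h | h
        · exact h2 i h
        · rw [Fin.ext h]
          exact hf j _ _ fun l hl => h3 l fun e => hk (e ▸ hl)
      linarith
  have hE : ∀ j : Fin K, 0 ≤ E j - E (j + 1) := by
    intro j
    refine sub_nonneg.2 (logFiberSum_le_of_imp fun w w' => ?_)
    rw [hpre, hpre]
    exact fun h i hi => h i (hi.trans (Nat.lt_succ_self _))
  -- Given the other coordinates, w_k has |A| values before any output is known and one value after
  -- all of them.
  have hG0 : ∀ k, G k 0 - G k K = Fintype.card (Fin K → A) * Real.log (Fintype.card A) := by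
    intro k
    have h0 : ∀ w, fiberCard (fun w => (rest k w, pre 0 w)) w = Fintype.card A := by
      intro w
      unfold fiberCard
      rw [← Finset.card_univ]
      symm
      refine Finset.card_bij (fun a _ => Function.update w k a) (fun a _ => ?_)
        (fun a _ b _ h => ?_) fun w' hw' => ?_
      · simp only [Finset.mem_filter, Finset.mem_univ, true_and, Prod.mk.injEq, hrest, hpre]
        exact ⟨fun j hj => Function.update_of_ne hj _ _, fun i hi => absurd hi (Nat.not_lt_zero _)⟩
      · simpa using congrFun h k
      · simp only [Finset.mem_filter, Finset.mem_univ, true_and, Prod.mk.injEq, hrest] at hw'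
        refine ⟨w' k, Finset.mem_univ _, funext fun j => ?_⟩
        by_cases hj : j = k
        · subst hj; simp
        · rw [Function.update_of_ne hj, hw'.1 j hj]
    have hK : ∀ w, fiberCard (fun w => (rest k w, pre K w)) w = 1 := by
      intro w
      unfold fiberCard
      rw [Finset.card_eq_one]
      refine ⟨w, ?_⟩
      ext w'
      simp only [Finset.mem_filter, Finset.mem_univ, true_and, Prod.mk.injEq, hrest, hpre,
        Finset.mem_singleton]
      exact ⟨fun h => hinj k _ _ h.1 fun i => h.2 i i.2, fun h => h ▸ ⟨fun _ _ => rfl, fun _ _ => rfl⟩⟩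
    simp only [G, logFiberSum, h0, hK]
    simp
  have htel : ∀ g : ℕ → ℝ, ∑ j : Fin K, (g j - g (j + 1)) = g 0 - g K := by
    intro g
    rw [Fin.sum_univ_eq_sum_range (fun j => g j - g (j + 1)), Finset.sum_range_sub']
  -- The chain rule is summed over k; the entropy increment of output j is charged once for each of
  -- its at most B inputs.
  have hmain : (K : ℝ) * (Fintype.card (Fin K → A) * Real.log (Fintype.card A)) ≤
      B * (E 0 - E K) := by
    calc (K : ℝ) * (Fintype.card (Fin K → A) * Real.log (Fintype.card A))
        = ∑ k : Fin K, (G k 0 - G k K) := by simp [hG0]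
      _ ≤ ∑ k : Fin K, ∑ j : Fin K, if k ∈ N j then E j - E (j + 1) else 0 := by
          refine Finset.sum_le_sum fun k _ => ?_
          rw [← htel (G k)]
          exact Finset.sum_le_sum fun j _ => hG k j
      _ = ∑ j : Fin K, ((N j).card : ℝ) * (E j - E (j + 1)) := by
          rw [Finset.sum_comm]
          refine Finset.sum_congr rfl fun j _ => ?_
          rw [Finset.sum_ite_mem, Finset.univ_inter, Finset.sum_const, nsmul_eq_mul]
      _ ≤ ∑ j : Fin K, (B : ℝ) * (E j - E (j + 1)) :=
          Finset.sum_le_sum fun j _ =>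
            mul_le_mul_of_nonneg_right (by exact_mod_cast hN j) (hE j)
      _ = B * (E 0 - E K) := by rw [← Finset.mul_sum, htel]
  have hE0 : E 0 = Fintype.card (Fin K → A) * Real.log (Fintype.card (Fin K → A)) := by
    have h0 : ∀ w, fiberCard (pre 0) w = Fintype.card (Fin K → A) := by
      intro w
      unfold fiberCard
      rw [← Finset.card_univ]
      congr 1
      ext w'
      simp [hpre]
    simp only [E, logFiberSum, h0, Finset.sum_const, Finset.card_univ, nsmul_eq_mul]
  have hEK : E K = logFiberSum fun w i => f i w := by
    refine logFiberSum_congr fun w w' => ?_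
    rw [hpre, funext_iff]
    exact ⟨fun h i => h i i.2, fun h i _ => h i⟩
  have hpos : (0 : ℝ) < Fintype.card (Fin K → A) := by exact_mod_cast Fintype.card_pos
  set M := (Finset.univ.image fun w i => f i w).card with hM
  have himg : E 0 ≤ E K + Fintype.card (Fin K → A) * Real.log M := by
    rw [hE0, hEK, hM]
    convert card_mul_log_card_le fun w i => f i w
  have hMpos : 0 < M := Finset.card_pos.2 (Finset.univ_nonempty.image _)
  have hA : 0 < Fintype.card A := Fintype.card_pos
  have hlog : (K : ℝ) * Real.log (Fintype.card A) ≤ B * Real.log M := by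
    have h1 : (B : ℝ) * (E 0 - E K) ≤ B * (Fintype.card (Fin K → A) * Real.log M) :=
      mul_le_mul_of_nonneg_left (by linarith) (Nat.cast_nonneg _)
    have h2 : Fintype.card (Fin K → A) * ((K : ℝ) * Real.log (Fintype.card A)) ≤
        Fintype.card (Fin K → A) * (B * Real.log M) := by linarith
    exact le_of_mul_le_mul_left h2 hpos
  rw [← Real.log_pow, ← Real.log_pow, Real.log_le_log_iff (by positivity) (by positivity)] at hlog
  exact_mod_cast hlog

end Shearer

/-! ### Double counting for the cyclic association -/

theorem mem_usersOf {K B : ℕ} {i k : Fin K} : k ∈ usersOf K B i ↔ i ∈ relaysOf K B k := by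
  simp [usersOf, relaysOf]

theorem card_relaysOf {K B : ℕ} (hB : B ≤ K) (k : Fin K) : (relaysOf K B k).card = B := by
  have : NeZero K := ⟨fun h => by subst h; exact k.elim0⟩
  have h : (relaysOf K B k).card = (Finset.univ.filter fun i : Fin K => (i : ℕ) < B).card := by
    refine Finset.card_bij (fun i _ => i - k) (fun i hi => by simpa [relaysOf] using hi)
      (fun i _ j _ h => sub_left_injective h) fun j hj => ⟨j + k, ?_, by simp⟩
    simpa [relaysOf] using hj
  rw [h, Fin.card_filter_val_lt, min_eq_right hB]

theorem card_usersOf {K B : ℕ} (hB : B ≤ K) (i : Fin K) : (usersOf K B i).card = B := by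
  have : NeZero K := ⟨fun h => by subst h; exact i.elim0⟩
  have h : (usersOf K B i).card = (Finset.univ.filter fun i : Fin K => (i : ℕ) < B).card := by
    refine Finset.card_bij (fun k _ => i - k) (fun k hk => by simpa [usersOf] using hk)
      (fun a _ b _ h => sub_right_injective h) fun j hj => ⟨i - j, ?_, by simp⟩
    simpa [usersOf] using hj
  rw [h, Fin.card_filter_val_lt, min_eq_right hB]

theorem sum_relaysOf_comm {K B : ℕ} {M : Type} [AddCommMonoid M] (f : Fin K → Fin K → M) :
    ∑ k, ∑ i ∈ relaysOf K B k, f k i = ∑ i, ∑ k ∈ usersOf K B i, f k i := by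
  refine Finset.sum_comm' fun k i => ?_
  simp [mem_usersOf]

theorem prod_relaysOf_comm {K B : ℕ} {M : Type} [CommMonoid M] (f : Fin K → Fin K → M) :
    ∏ k, ∏ i ∈ relaysOf K B k, f k i = ∏ i, ∏ k ∈ usersOf K B i, f k i := by
  refine Finset.prod_comm' fun k i => ?_
  simp [mem_usersOf]

theorem le_of_card_pow_le {F : Type} [Field F] [Fintype F] {m n : ℕ}
    (h : Fintype.card F ^ m ≤ Fintype.card F ^ n) : m ≤ n :=
  (Nat.pow_le_pow_iff_right Fintype.one_lt_card).1 h

/-! ### Converse bounds by counting values -/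

namespace Scheme

variable {K B : ℕ} {F : Type} [Field F] [Fintype F] (s : Scheme K B F)

/-- A good sample point with prescribed inputs and a fixed value of the keys. -/
noncomputable def point (w : Fin K → Fin s.L → F) : s.Ω :=
  (s.exists_good_W_Z w s.good_nonempty.some_mem).choose

theorem point_good (w : Fin K → Fin s.L → F) : s.point w ∈ s.good :=
  (s.exists_good_W_Z w s.good_nonempty.some_mem).choose_spec.1

theorem W_point (w : Fin K → Fin s.L → F) (k : Fin K) : s.W k (s.point w) = w k :=
  (s.exists_good_W_Z w s.good_nonempty.some_mem).choose_spec.2.1 k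

theorem Z_point (w w' : Fin K → Fin s.L → F) (k : Fin K) :
    s.Z k (s.point w) = s.Z k (s.point w') :=
  ((s.exists_good_W_Z w s.good_nonempty.some_mem).choose_spec.2.2 k).trans
    ((s.exists_good_W_Z w' s.good_nonempty.some_mem).choose_spec.2.2 k).symm

theorem X_point_congr {w w' : Fin K → Fin s.L → F} {k i : Fin K} (h : w k = w' k)
    (hi : i ∈ relaysOf K B k) : s.X k i (s.point w) = s.X k i (s.point w') :=
  s.X_eq_of_eq (s.point_good w) (s.point_good w') (by rw [W_point, W_point, h]) (s.Z_point w w' k)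
    hi

theorem Y_point_congr {w w' : Fin K → Fin s.L → F} {i : Fin K}
    (h : ∀ k ∈ usersOf K B i, w k = w' k) : s.Y i (s.point w) = s.Y i (s.point w') :=
  s.Y_eq_of_eq (s.point_good w) (s.point_good w') fun k hk =>
    s.X_point_congr (h k hk) (mem_usersOf.1 hk)

/-- Relays not serving k see no difference, so all outputs agree. Recovery then equates the sums,
which differ at most through coordinate k. -/
theorem eq_of_Y_point_eq {w w' : Fin K → Fin s.L → F} {k : Fin K} (h : ∀ j, j ≠ k → w j = w' j)
    (hY : ∀ i ∈ relaysOf K B k, s.Y i (s.point w) = s.Y i (s.point w')) : w = w' := by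
  have hY' : ∀ i, s.Y i (s.point w) = s.Y i (s.point w') := by
    intro i
    by_cases hi : i ∈ relaysOf K B k
    · exact hY i hi
    · exact s.Y_point_congr fun j hj => h j fun e => hi (by rw [← e]; exact mem_usersOf.1 hj)
  have hs := s.sum_W_eq_of_Y_eq (s.point_good w) (s.point_good w') hY'
  simp only [W_point] at hs
  rw [← Finset.add_sum_erase _ w (Finset.mem_univ k),
    ← Finset.add_sum_erase _ w' (Finset.mem_univ k),
    Finset.sum_congr rfl fun j hj => h j (Finset.ne_of_mem_erase hj)] at hs
  funext j
  by_cases hj : j = k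
  · rw [hj]; exact add_right_cancel hs
  · exact h j hj

theorem eq_of_X_point_update_eq {k : Fin K} {a b : Fin s.L → F}
    (h : ∀ i ∈ relaysOf K B k, s.X k i (s.point (Function.update 0 k a)) =
      s.X k i (s.point (Function.update 0 k b))) : a = b := by
  have hw : Function.update (0 : Fin K → Fin s.L → F) k a =
      Function.update (0 : Fin K → Fin s.L → F) k b := by
    refine s.eq_of_Y_point_eq (k := k) (fun j hj => by simp [Function.update_of_ne hj]) ?_
    intro i hi
    refine s.Y_eq_of_eq (s.point_good _) (s.point_good _) fun j hj => ?_
    by_cases hjk : j = k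
    · subst hjk; exact h i hi
    · exact s.X_point_congr (by simp [Function.update_of_ne hjk]) (mem_usersOf.1 hj)
  simpa using congrFun hw k

theorem L_le_LXtot (k : Fin K) : s.L ≤ s.LXtot := by
  refine le_of_card_pow_le (F := F) ?_
  have h := Fintype.card_le_of_injective
    (fun (a : Fin s.L → F) (i : {i // i ∈ relaysOf K B k}) =>
      s.X k i (s.point (Function.update 0 k a)))
    fun a b hab => s.eq_of_X_point_update_eq fun i hi => congrFun hab ⟨i, hi⟩
  simp only [Fintype.card_pi, Finset.prod_const, Finset.card_univ, Fintype.card_fin] at h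
  rwa [Finset.prod_coe_sort (relaysOf K B k) fun i => Fintype.card F ^ s.LX k i,
    Finset.prod_pow_eq_pow_sum, s.LX_sum] at h

theorem L_le_sum_LY_relaysOf (k : Fin K) : s.L ≤ ∑ i ∈ relaysOf K B k, s.LY i := by
  refine le_of_card_pow_le (F := F) ?_
  have h := Fintype.card_le_of_injective
    (fun (a : Fin s.L → F) (i : {i // i ∈ relaysOf K B k}) =>
      s.Y i (s.point (Function.update 0 k a))) (fun a b hab => by
        have := s.eq_of_Y_point_eq (k := k) (fun j hj => by simp [Function.update_of_ne hj])
          fun i hi => congrFun hab ⟨i, hi⟩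
        simpa using congrFun this k)
  simp only [Fintype.card_pi, Finset.prod_const, Finset.card_univ, Fintype.card_fin] at h
  rwa [Finset.prod_coe_sort (relaysOf K B k) fun i => Fintype.card F ^ s.LY i,
    Finset.prod_pow_eq_pow_sum] at h

theorem K_mul_L_le_B_mul_sum_LY (hB : B ≤ K) : K * s.L ≤ B * ∑ i, s.LY i := by
  have h := Finset.sum_le_sum fun k (_ : k ∈ Finset.univ) => s.L_le_sum_LY_relaysOf k
  rw [sum_relaysOf_comm] at h
  simpa [card_usersOf hB, ← Finset.mul_sum] using h

/-- Relay security freezes the messages at relay i, hence Y_i, while the input sum takes all q^L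
values; the other relays must distinguish them. -/
theorem L_le_sum_LY_erase (i : Fin K) : s.L ≤ ∑ j ∈ Finset.univ.erase i, s.LY j := by
  refine le_of_card_pow_le (F := F) ?_
  choose P hP hW hX using fun a : Fin s.L → F =>
    s.exists_good_W_X (Function.update 0 i a) (s.point_good 0) i
  have hY : ∀ a, s.Y i (P a) = s.Y i (s.point 0) := fun a =>
    s.Y_eq_of_eq (hP a) (s.point_good 0) (hX a)
  have h := Fintype.card_le_of_injective
    (fun (a : Fin s.L → F) (j : {j // j ∈ Finset.univ.erase i}) => s.Y j (P a))
    (fun a b hab => by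
      have h1 := s.sum_W_eq_of_Y_eq (hP a) (hP b) fun j => by
        by_cases hj : j = i
        · subst hj; rw [hY, hY]
        · exact congrFun hab ⟨j, by simpa using hj⟩
      simpa [hW, Finset.sum_update_of_mem] using h1)
  simp only [Fintype.card_pi, Finset.prod_const, Finset.card_univ, Fintype.card_fin] at h
  rwa [Finset.prod_coe_sort (Finset.univ.erase i) fun j => Fintype.card F ^ s.LY j,
    Finset.prod_pow_eq_pow_sum] at h

theorem K_mul_L_le_pred_mul_sum_LY : K * s.L ≤ (K - 1) * ∑ i, s.LY i := by
  have h := Finset.sum_le_sum fun i (_ : i ∈ Finset.univ) => s.L_le_sum_LY_erase i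
  have e : ∑ i : Fin K, ∑ j ∈ Finset.univ.erase i, s.LY j =
      ∑ j : Fin K, ∑ i ∈ Finset.univ.erase j, s.LY j :=
    Finset.sum_comm' fun i j => by simp [ne_comm]
  rw [e] at h
  simpa [← Finset.mul_sum] using h

open scoped Classical in
/-- The values of the message from user `k` to relay `i` for fixed keys. -/
noncomputable def messages (k i : Fin K) : Finset (Fin (s.LX k i) → F) :=
  Finset.univ.image fun w => s.X k i (s.point w)

theorem exists_of_mem_messages {k i : Fin K} {x : Fin (s.LX k i) → F}
    (hx : x ∈ s.messages k i) : ∃ w, s.X k i (s.point w) = x := by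
  simpa [messages] using hx

theorem pow_L_le_prod_card_messages (k : Fin K) :
    Fintype.card F ^ s.L ≤ ∏ i ∈ relaysOf K B k, (s.messages k i).card := by
  have h := Fintype.card_le_of_injective
    (fun (a : Fin s.L → F) (i : {i // i ∈ relaysOf K B k}) =>
      (⟨s.X k i (s.point (Function.update 0 k a)), by simp [messages]⟩ : s.messages k i))
    fun a b hab => s.eq_of_X_point_update_eq fun i hi =>
      congrArg Subtype.val (congrFun hab ⟨i, hi⟩)
  simp only [Fintype.card_pi, Finset.prod_const, Finset.card_univ, Fintype.card_fin,
    Fintype.card_coe] at h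
  rwa [Finset.prod_coe_sort (relaysOf K B k) fun i => (s.messages k i).card] at h

/-- Each such message also occurs with all inputs 0 by relay security. There it is a function of the
key Z_k alone. -/
theorem card_messages_le {k i : Fin K} (hi : i ∈ relaysOf K B k) :
    (s.messages k i).card ≤ Fintype.card F ^ s.LZ := by
  choose v hv using fun x : s.messages k i => s.exists_of_mem_messages x.2
  choose P hP hW hX using fun x : s.messages k i =>
    s.exists_good_W_X 0 (s.point_good (v x)) i
  have h := Fintype.card_le_of_injective (fun x : s.messages k i => s.Z k (P x)) fun x y hxy => by
    have h1 := s.X_eq_of_eq (hP x) (hP y) (by rw [hW, hW]) hxy hi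
    rw [hX _ _ (mem_usersOf.2 hi), hX _ _ (mem_usersOf.2 hi), hv, hv] at h1
    exact Subtype.ext h1
  simpa using h

theorem L_le_B_mul_LZ (hB : B ≤ K) (k : Fin K) : s.L ≤ B * s.LZ := by
  refine le_of_card_pow_le (F := F) ?_
  refine (s.pow_L_le_prod_card_messages k).trans ?_
  refine (Finset.prod_le_prod' fun i hi => s.card_messages_le hi).trans ?_
  rw [Finset.prod_const, card_relaysOf hB, ← pow_mul, mul_comm]

theorem eq_of_S_eq {ω ω' : s.Ω} (h : ω ∈ s.good) (h' : ω' ∈ s.good)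
    (hW : ∀ k, s.W k ω = s.W k ω') (hS : s.S ω = s.S ω') :
    (∀ k, ∀ i ∈ relaysOf K B k, s.X k i ω = s.X k i ω') ∧ ∀ i, s.Y i ω = s.Y i ω' := by
  have hX : ∀ k, ∀ i ∈ relaysOf K B k, s.X k i ω = s.X k i ω' := fun k i hi =>
    s.X_eq_of_eq h h' (hW k) (s.Z_eq_of_S_eq h h' hS k) hi
  exact ⟨hX, fun i => s.Y_eq_of_eq h h' fun k hk => hX k i (mem_usersOf.1 hk)⟩

/-- Same argument for all messages at relay i together, which for zero inputs are a function of the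
source key. -/
theorem prod_card_messages_le (i : Fin K) :
    ∏ k ∈ usersOf K B i, (s.messages k i).card ≤ Fintype.card F ^ s.LS := by
  classical
  choose v hv using fun (k : Fin K) (x : s.messages k i) => s.exists_of_mem_messages x.2
  -- Under frozen keys a message depends only on the input of its own user, so arbitrary choices of
  -- one message per user occur together.
  let w : ((k : {k // k ∈ usersOf K B i}) → s.messages k i) → Fin K → Fin s.L → F :=
    fun x k => if h : k ∈ usersOf K B i then v k (x ⟨k, h⟩) k else 0
  have hw : ∀ x, ∀ k : {k // k ∈ usersOf K B i}, s.X k i (s.point (w x)) = x k := by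
    intro x k
    rw [← hv k (x k)]
    exact s.X_point_congr (by simp [w, k.2]) (mem_usersOf.1 k.2)
  choose P hP hW hX using fun x => s.exists_good_W_X 0 (s.point_good (w x)) i
  have h := Fintype.card_le_of_injective (fun x => s.S (P x)) fun x y hxy => by
    have h1 := (s.eq_of_S_eq (hP x) (hP y) (fun k => by rw [hW, hW]) hxy).1
    funext k
    have h2 := h1 k i (mem_usersOf.1 k.2)
    rw [hX _ _ k.2, hX _ _ k.2, hw, hw] at h2
    exact Subtype.ext h2
  simp only [Fintype.card_pi, Finset.prod_const, Finset.card_univ, Fintype.card_fin,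
    Fintype.card_coe] at h
  rwa [Finset.prod_coe_sort (usersOf K B i) fun k => (s.messages k i).card] at h

/-- The product of the message counts over all connected pairs is at least q^(KL), grouped by users,
and at most q^(K·LS), grouped by relays. -/
theorem L_le_LS (k : Fin K) : s.L ≤ s.LS := by
  have h1 := Finset.prod_le_prod' fun k (_ : k ∈ Finset.univ) => s.pow_L_le_prod_card_messages k
  rw [prod_relaysOf_comm] at h1
  have h2 := h1.trans (Finset.prod_le_prod' fun i _ => s.prod_card_messages_le i)
  simp only [Finset.prod_const, Finset.card_univ, Fintype.card_fin, ← pow_mul] at h2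
  exact Nat.le_of_mul_le_mul_right (le_of_card_pow_le h2) (Fin.pos k)

/-- Server security realises each output vector with the whole input sum placed on user k. It is
then determined by that sum and the source key. -/
theorem ncard_range_Y_point_le (k : Fin K) :
    (Set.range fun w i => s.Y i (s.point w)).ncard ≤ Fintype.card F ^ (s.L + s.LS) := by
  have hmem : ∀ y : Set.range fun w i => s.Y i (s.point w),
      ∃ w, (fun i => s.Y i (s.point w)) = y.1 := fun y => y.2
  choose v hv using hmem
  choose P hP hW hY using fun y => s.exists_good_W_Y
    (Function.update 0 k (∑ j, v y j)) (s.point_good (v y))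
    (by simp [W_point, Finset.sum_update_of_mem])
  have h := Nat.card_le_card_of_injective (fun y => (∑ j, v y j, s.S (P y))) fun x y hxy => by
    simp only [Prod.mk.injEq] at hxy
    have h1 := (s.eq_of_S_eq (hP x) (hP y) (fun j => by rw [hW, hW, hxy.1]) hxy.2).2
    apply Subtype.ext
    rw [← hv x, ← hv y]
    funext i
    rw [← hY x, ← hY y]
    exact h1 i
  rw [Nat.card_coe_set_eq, Nat.card_eq_fintype_card, Fintype.card_prod, Fintype.card_fun,
    Fintype.card_fun, Fintype.card_fin, Fintype.card_fin, ← pow_add] at h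
  exact h

theorem K_mul_L_le_B_mul_add (hB : B ≤ K) (k : Fin K) : K * s.L ≤ B * (s.L + s.LS) := by
  have h1 := card_pow_le_card_image_pow (A := Fin s.L → F) (fun i w => s.Y i (s.point w))
    (usersOf K B) (fun i => (card_usersOf hB i).le) (fun i w w' h => s.Y_point_congr h)
    (fun k w w' h hY => s.eq_of_Y_point_eq h fun i _ => hY i)
  have h3 := h1.trans (Nat.pow_le_pow_left (s.ncard_range_Y_point_le k) B)
  rw [Fintype.card_fun, Fintype.card_fin, ← pow_mul, ← pow_mul] at h3
  have := le_of_card_pow_le h3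
  linarith [mul_comm K s.L, mul_comm B (s.L + s.LS)]

/-- The bounds on the rates of a scheme. -/
theorem rates_bounds (hK : 2 ≤ K) (hB1 : 1 ≤ B) (hB : B ≤ K) :
    1 ≤ s.rates.1 ∧ 1 / (B : ℝ) ≤ s.rates.2.1 ∧ 1 / ((K : ℝ) - 1) ≤ s.rates.2.1 ∧
      1 / (B : ℝ) ≤ s.rates.2.2.1 ∧ max 1 ((K : ℝ) / B - 1) ≤ s.rates.2.2.2 := by
  let k : Fin K := ⟨0, by omega⟩
  have hL : (0 : ℝ) < s.L := by exact_mod_cast s.L_pos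
  have hB0 : (0 : ℝ) < B := by exact_mod_cast hB1
  have hK0 : (0 : ℝ) < K := by exact_mod_cast (by omega : 0 < K)
  have hK1 : (0 : ℝ) < (K : ℝ) - 1 := by
    have : (2 : ℝ) ≤ K := by exact_mod_cast hK
    linarith
  have h1 : (s.L : ℝ) ≤ s.LXtot := by exact_mod_cast s.L_le_LXtot k
  have h2 : (K : ℝ) * s.L ≤ B * ∑ i, (s.LY i : ℝ) := by
    exact_mod_cast s.K_mul_L_le_B_mul_sum_LY hB
  have h3 : (K : ℝ) * s.L ≤ (K - 1) * ∑ i, (s.LY i : ℝ) := by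
    have := s.K_mul_L_le_pred_mul_sum_LY
    have h : ((K * s.L : ℕ) : ℝ) ≤ ((K - 1 : ℕ) * ∑ i, s.LY i : ℕ) := by exact_mod_cast this
    push_cast [Nat.cast_sub (by omega : 1 ≤ K)] at h
    exact h
  have h4 : (s.L : ℝ) ≤ B * s.LZ := by exact_mod_cast s.L_le_B_mul_LZ hB k
  have h5 : (s.L : ℝ) ≤ s.LS := by exact_mod_cast s.L_le_LS k
  have h6 : (K : ℝ) * s.L ≤ B * (s.L + s.LS) := by exact_mod_cast s.K_mul_L_le_B_mul_add hB k
  simp only [rates]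
  refine ⟨?_, ?_, ?_, ?_, max_le ?_ ?_⟩
  · rwa [le_div_iff₀ hL, one_mul]
  · rw [div_le_div_iff₀ hB0 (by positivity)]; linarith
  · rw [div_le_div_iff₀ hK1 (by positivity)]; linarith
  · rw [div_le_div_iff₀ hB0 hL]; linarith
  · rwa [le_div_iff₀ hL, one_mul]
  · rw [le_div_iff₀ hL, sub_mul, sub_le_iff_le_add, div_mul_eq_mul_div, div_le_iff₀ hB0]
    linarith

end Scheme

theorem optimalRegion_bounds {K B : ℕ} {F : Type} [Field F] [Fintype F] (hK : 2 ≤ K)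
    (hB1 : 1 ≤ B) (hB : B ≤ K) {r : ℝ × ℝ × ℝ × ℝ} (hr : r ∈ optimalRegion K B F) :
    1 ≤ r.1 ∧ 1 / (B : ℝ) ≤ r.2.1 ∧ 1 / ((K : ℝ) - 1) ≤ r.2.1 ∧
      1 / (B : ℝ) ≤ r.2.2.1 ∧ max 1 ((K : ℝ) / B - 1) ≤ r.2.2.2 := by
  have hcl : IsClosed {r : ℝ × ℝ × ℝ × ℝ | 1 ≤ r.1 ∧ 1 / (B : ℝ) ≤ r.2.1 ∧
      1 / ((K : ℝ) - 1) ≤ r.2.1 ∧ 1 / (B : ℝ) ≤ r.2.2.1 ∧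
      max 1 ((K : ℝ) / B - 1) ≤ r.2.2.2} := by
    simp only [Set.ofPred_and]
    exact (isClosed_le continuous_const (by fun_prop)).inter <|
      (isClosed_le continuous_const (by fun_prop)).inter <|
      (isClosed_le continuous_const (by fun_prop)).inter <|
      (isClosed_le continuous_const (by fun_prop)).inter
      (isClosed_le continuous_const (by fun_prop))
  refine closure_minimal ?_ hcl hr
  rintro _ ⟨s, rfl⟩
  exact s.rates_bounds hK hB1 hB

/-! ### Generic choice of the noise polynomials -/

section Generic

open Polynomial

/-- Induction on the conditions: join a point satisfying the old ones to a point satisfying the new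
one. On that line each condition holds somewhere, so it excludes few points, and together they
exclude fewer than q. -/
theorem exists_forall_of_line {F E ι : Type} [Field F] [Fintype F] [AddCommGroup E] [Module F E]
    (I : Finset ι) (P : ι → E → Prop) (D : ι → ℕ) (hex : ∀ i, ∃ x, P i x)
    (hline : ∀ i x v (t₀ : F), P i (x + t₀ • v) → {t : F | ¬ P i (x + t • v)}.ncard ≤ D i)
    (hD : ∑ i ∈ I, D i < Fintype.card F) : ∃ x, ∀ i ∈ I, P i x := by
  classical
  induction I using Finset.induction_on with
  | empty => exact ⟨0, by simp⟩
  | insert i I hi ih =>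
    have hD' := hD
    rw [Finset.sum_insert hi] at hD'
    obtain ⟨x, hx⟩ := ih (by omega)
    obtain ⟨y, hy⟩ := hex i
    have hbad : ∀ j ∈ insert i I, {t : F | ¬ P j (x + t • (y - x))}.ncard ≤ D j := by
      intro j hj
      rcases Finset.mem_insert.1 hj with rfl | hj
      · exact hline j x (y - x) 1 (by simpa using hy)
      · exact hline j x (y - x) 0 (by simpa using hx j hj)
    have hcard := ((insert i I).set_ncard_biUnion_le
      fun j => {t : F | ¬ P j (x + t • (y - x))}).trans (Finset.sum_le_sum hbad)
    have hne : (⋃ j ∈ insert i I, {t : F | ¬ P j (x + t • (y - x))}) ≠ Set.univ := by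
      intro h
      rw [h, Set.ncard_univ, Nat.card_eq_fintype_card] at hcard
      omega
    obtain ⟨t, ht⟩ := (Set.ne_univ_iff_exists_notMem _).1 hne
    refine ⟨x + t • (y - x), fun j hj => ?_⟩
    by_contra hP
    exact ht (Set.mem_biUnion hj hP)

/-- Along a line the determinant is a polynomial in t of degree at most the matrix size, and it is
nonzero because of its value at `t₀`. -/
theorem ncard_det_line_le {F E n : Type} [Field F] [AddCommGroup E] [Module F E]
    [Fintype n] [DecidableEq n] (φ : n → n → E →ₗ[F] F) (x v : E) (t₀ : F)
    (h : (Matrix.of fun i j => φ i j (x + t₀ • v)).det ≠ 0) :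
    {t : F | ¬ (Matrix.of fun i j => φ i j (x + t • v)).det ≠ 0}.ncard ≤ Fintype.card n := by
  classical
  let f : F[X] := ((X : F[X]) • (Matrix.of fun i j => φ i j v).map C +
    (Matrix.of fun i j => φ i j x).map C).det
  have hf : ∀ t, f.eval t = (Matrix.of fun i j => φ i j (x + t • v)).det := by
    intro t
    rw [← coe_evalRingHom, RingHom.map_det]
    congr 1
    ext i j
    simp
    ring
  have hf0 : f ≠ 0 := fun h0 => h (by rw [← hf, h0, eval_zero])
  calc {t : F | ¬ (Matrix.of fun i j => φ i j (x + t • v)).det ≠ 0}.ncard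
      ≤ (f.roots.toFinset : Set F).ncard := by
        refine Set.ncard_le_ncard (fun t ht => ?_) (Finset.finite_toSet _)
        simp only [Set.mem_ofPred_eq, not_not] at ht
        rw [← hf] at ht
        simpa [hf0] using ht
    _ = f.roots.toFinset.card := Set.ncard_coe_finset _
    _ ≤ f.natDegree := (Multiset.toFinset_card_le _).trans (card_roots' f)
    _ ≤ Fintype.card n := natDegree_det_X_add_C_le _ _

variable {K b : ℕ} {F : Type} [Field F]

/-- The monic polynomial whose roots are the nodes of the relays not connected to user `k`. -/
noncomputable def annihilator (b : ℕ) (α : Fin K → F) (k : Fin K) : F[X] :=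
  ∏ i ∈ (relaysOf K b k)ᶜ, (X - C (α i))

theorem annihilator_monic (α : Fin K → F) (k : Fin K) : (annihilator b α k).Monic :=
  monic_prod_of_monic _ _ fun _ _ => monic_X_sub_C _

theorem natDegree_annihilator (hb : b ≤ K) (α : Fin K → F) (k : Fin K) :
    (annihilator b α k).natDegree = K - b := by
  rw [annihilator, natDegree_finsetProd_X_sub_C_eq_card, Finset.card_compl, card_relaysOf hb,
    Fintype.card_fin]

theorem eval_annihilator_eq_zero_iff {α : Fin K → F} (hα : Function.Injective α) (k i : Fin K) :
    (annihilator b α k).eval (α i) = 0 ↔ i ∉ relaysOf K b k := by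
  rw [annihilator, eval_prod, Finset.prod_eq_zero_iff]
  constructor
  · rintro ⟨j, hj, h⟩
    rw [eval_sub, eval_X, eval_C, sub_eq_zero] at h
    rw [hα h]
    simpa using hj
  · exact fun h => ⟨i, by simpa using h, by simp⟩

/-- The polynomial describing the key coefficients of user `k`. -/
noncomputable def keyPoly (b : ℕ) {r : ℕ} (α : Fin K → F) (c : Fin K → degreeLT F r) (k : Fin K) :
    F[X] := annihilator b α k * (c k : F[X])

/-- `keyPoly` as a linear map of the free parameters. -/
noncomputable def keyPolyLin (b r : ℕ) (α : Fin K → F) (k : Fin K) :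
    (Fin K → degreeLT F r) →ₗ[F] F[X] :=
  LinearMap.mulLeft F (annihilator b α k) ∘ₗ (degreeLT F r).subtype ∘ₗ LinearMap.proj k

theorem keyPolyLin_apply {r : ℕ} (α : Fin K → F) (c : Fin K → degreeLT F r) (k : Fin K) :
    keyPolyLin b r α k c = keyPoly b α c k := rfl

theorem degree_keyPoly_lt (hb : b ≤ K) {r : ℕ} (α : Fin K → F)
    (c : Fin K → degreeLT F r) (k : Fin K) :
    (keyPoly b α c k).degree < ((K - b + r : ℕ) : WithBot ℕ) := by
  by_cases h0 : (c k : F[X]) = 0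
  · rw [keyPoly, h0, mul_zero, degree_zero]
    exact WithBot.bot_lt_coe _
  · have h := mem_degreeLT.1 (c k).2
    rw [keyPoly, degree_mul, degree_eq_natDegree (annihilator_monic α k).ne_zero,
      natDegree_annihilator hb, Nat.cast_add]
    exact WithBot.add_lt_add_left (WithBot.coe_ne_bot) h

theorem mem_relaysOf_self (hb : 1 ≤ b) (k : Fin K) : k ∈ relaysOf K b k := by
  have : NeZero K := ⟨fun h => by subst h; exact k.elim0⟩
  simp [relaysOf]
  omega

/-- The three conditions serve, in turn, to make every used key coefficient nonzero, to let the
users `κ i` absorb the key constraints, and to make the first K - b + r noise polynomials a basis of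
the polynomials of degree < K - b + r. Each is the nonvanishing of a determinant linear in `c`
entrywise, so one witness for each suffices. -/
theorem exists_generic [Fintype F] (hb : 1 ≤ b) (hbK : b < K) {r : ℕ} (hr : 1 ≤ r)
    (hrs : r ≤ b) (hq : 2 * K * K + K < Fintype.card F) {α : Fin K → F}
    (hα : Function.Injective α) (κ : Fin K → Fin r → Fin K)
    (hκ : ∀ i, Function.Injective (κ i)) (hm : K - b + r ≤ K) :
    ∃ c : Fin K → degreeLT F r, (∀ k i, ((c k : F[X])).eval (α i) ≠ 0) ∧
      (∀ i, (Matrix.of fun l j : Fin r =>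
        (keyPoly b α c (κ i l)).coeff (K - b + j)).det ≠ 0) ∧
      (Matrix.of fun l j : Fin (K - b + r) =>
        (keyPoly b α c (Fin.castLE hm l)).eval (α (Fin.castLE hm j))).det ≠ 0 := by
  classical
  let ι := (Fin K × Fin K) ⊕ Fin K ⊕ Unit
  let φ₁ : Fin K × Fin K → Unit → Unit → (Fin K → degreeLT F r) →ₗ[F] F := fun a _ _ =>
    leval (α a.2) ∘ₗ (degreeLT F r).subtype ∘ₗ LinearMap.proj a.1
  let φ₂ : Fin K → Fin r → Fin r → (Fin K → degreeLT F r) →ₗ[F] F := fun i l j =>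
    lcoeff F (K - b + j) ∘ₗ keyPolyLin b r α (κ i l)
  let φ₃ : Fin (K - b + r) → Fin (K - b + r) → (Fin K → degreeLT F r) →ₗ[F] F := fun l j =>
    leval (α (Fin.castLE hm j)) ∘ₗ keyPolyLin b r α (Fin.castLE hm l)
  let P : ι → (Fin K → degreeLT F r) → Prop := Sum.elim
    (fun a c => (Matrix.of fun i j => φ₁ a i j c).det ≠ 0) <| Sum.elim
    (fun i c => (Matrix.of fun l j => φ₂ i l j c).det ≠ 0)
    (fun _ c => (Matrix.of fun l j => φ₃ l j c).det ≠ 0)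
  let D : ι → ℕ := Sum.elim (fun _ => 1) <| Sum.elim (fun _ => r) (fun _ => K - b + r)
  have hg := fun k => natDegree_annihilator hbK.le α k
  have h1 : ∀ a, ∃ c, P (Sum.inl a) c := by
    intro a
    refine ⟨fun _ => ⟨1, mem_degreeLT.2 (by rw [degree_one]; exact_mod_cast hr)⟩, ?_⟩
    simp [P, φ₁, leval]
  have h2 : ∀ i, ∃ c, P (Sum.inr (Sum.inl i)) c := by
    intro i
    -- With multiplier X^l the noise polynomial is monic of degree K - b + l, so the coefficient
    -- matrix is lower triangular with ones on the diagonal.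
    let x : Fin r → degreeLT F r := fun l =>
      ⟨X ^ (l : ℕ), mem_degreeLT.2 (by rw [degree_X_pow]; exact_mod_cast l.2)⟩
    refine ⟨Function.extend (κ i) x 0, ?_⟩
    have he : ∀ l j, φ₂ i l j (Function.extend (κ i) x 0) =
        (annihilator b α (κ i l) * X ^ (l : ℕ)).coeff (K - b + j) := by
      intro l j
      simp only [φ₂, LinearMap.comp_apply, keyPolyLin_apply, keyPoly, lcoeff_apply,
        (hκ i).extend_apply]
      rfl
    simp only [P, Sum.elim_inr, Sum.elim_inl, he]
    rw [Matrix.det_of_isLowerTriangular]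
    · refine Finset.prod_ne_zero_iff.2 fun l _ => ?_
      rw [Matrix.of_apply, coeff_mul_X_pow', if_pos (by omega), Nat.add_sub_cancel,
        ← hg (κ i l), (annihilator_monic α _).coeff_natDegree]
      exact one_ne_zero
    · intro l j hlj
      have hlj : l < j := hlj
      have hlj' : (l : ℕ) < j := hlj
      rw [Matrix.of_apply, coeff_mul_X_pow', if_pos (by omega)]
      exact coeff_eq_zero_of_natDegree_lt (by rw [hg]; omega)
  have h3 : ∃ c, P (Sum.inr (Sum.inr ())) c := by
    -- The annihilator of user k vanishes at the K - b nodes cyclically preceding k. This factor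
    -- adds the nodes before those (truncated subtraction: none if k ≤ K - b), so the product
    -- vanishes at every node j < k and not at k.
    let y : Fin K → F[X] := fun k =>
      ∏ j ∈ Finset.univ.filter (fun j : Fin K => (j : ℕ) < k - (K - b)), (X - C (α j))
    have hy : ∀ k : Fin K, (k : ℕ) < K - b + r → y k ∈ degreeLT F r := by
      intro k hk
      rw [mem_degreeLT, degree_eq_natDegree (monic_prod_of_monic _ _ fun _ _ =>
        monic_X_sub_C _).ne_zero, natDegree_finsetProd_X_sub_C_eq_card, Fin.card_filter_val_lt]
      exact_mod_cast (by omega)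
    let c : Fin K → degreeLT F r := fun k =>
      if h : (k : ℕ) < K - b + r then ⟨y k, hy k h⟩ else 0
    refine ⟨c, ?_⟩
    have he : ∀ l j, φ₃ l j c = (annihilator b α (Fin.castLE hm l)).eval (α (Fin.castLE hm j)) *
        (y (Fin.castLE hm l)).eval (α (Fin.castLE hm j)) := by
      intro l j
      have hc : c (Fin.castLE hm l) = ⟨y (Fin.castLE hm l), hy _ (by simp)⟩ :=
        dif_pos (by simp)
      simp only [φ₃, LinearMap.comp_apply, keyPolyLin_apply, keyPoly, hc]
      exact eval_mul
    simp only [P, Sum.elim_inr, he]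
    rw [Matrix.det_of_isUpperTriangular]
    · refine Finset.prod_ne_zero_iff.2 fun l _ => ?_
      rw [Matrix.of_apply]
      refine mul_ne_zero ?_ ?_
      · rw [Ne, eval_annihilator_eq_zero_iff hα, not_not]
        exact mem_relaysOf_self hb _
      · rw [eval_prod]
        refine Finset.prod_ne_zero_iff.2 fun j hj => ?_
        rw [eval_sub, eval_X, eval_C, sub_ne_zero]
        intro h
        have := congrArg Fin.val (hα h)
        simp at hj this
        omega
    · intro l j hjl
      have hjl : j < l := hjl
      have hjl' : (j : ℕ) < l := hjl
      rw [Matrix.of_apply, mul_eq_zero]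
      by_cases h : (j : ℕ) < l - (K - b)
      · right
        rw [eval_prod]
        exact Finset.prod_eq_zero (i := Fin.castLE hm j) (by simpa using h) (by simp)
      · left
        rw [eval_annihilator_eq_zero_iff hα]
        simp only [relaysOf, Finset.mem_filter, Finset.mem_univ, true_and, Fin.val_sub,
          Fin.val_castLE]
        rw [Nat.mod_eq_of_lt (by omega)]
        omega
  obtain ⟨c, hc⟩ := exists_forall_of_line Finset.univ P D
    (by rintro (a | i | ⟨⟩) <;> [exact h1 a; exact h2 i; exact h3])
    (by
      rintro (a | i | ⟨⟩) x v t₀ h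
      · exact (ncard_det_line_le (φ₁ a) x v t₀ h).trans (by simp [D])
      · exact (ncard_det_line_le (φ₂ i) x v t₀ h).trans (by simp [D])
      · exact (ncard_det_line_le φ₃ x v t₀ h).trans (by simp [D]))
    (by
      -- The total is K² + Kr + (K - b + r), at most 2K² + K.
      simp only [ι, D, Fintype.sum_sum_type, Sum.elim_inl, Sum.elim_inr, Finset.sum_const,
        Finset.card_univ, Fintype.card_prod, Fintype.card_fin, smul_eq_mul, Fintype.card_unit]
      have : K * r ≤ K * K := Nat.mul_le_mul_left _ (by omega)
      nlinarith)
  refine ⟨c, fun k i => ?_, fun i => ?_, ?_⟩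
  · have := hc (Sum.inl (k, i)) (Finset.mem_univ _)
    simpa [P, φ₁, leval] using this
  · exact hc (Sum.inr (Sum.inl i)) (Finset.mem_univ _)
  · exact hc (Sum.inr (Sum.inr ())) (Finset.mem_univ _)

end Generic

/-! ### Linear codes from polynomial interpolation -/

open Polynomial

/-- A linear secure aggregation code for one block of `b` input symbols, using `d` source key
symbols: user `k` sends `A k w + z • β k`, where `z` is the `k`-th coordinate of `Φ s`, each relay
adds up what it receives, and the server applies `V`. -/
structure LinearCode (K b d : ℕ) (F : Type) [Field F] where
  /-- encoding of the inputs -/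
  A : Fin K → (Fin b → F) →ₗ[F] (Fin K → F)
  /-- decoding -/
  V : (Fin K → F) →ₗ[F] (Fin b → F)
  /-- encoding of the individual keys -/
  β : Fin K → Fin K → F
  /-- generation of the individual keys -/
  Φ : (Fin d → F) →ₗ[F] (Fin K → F)
  A_support : ∀ k w i, i ∉ relaysOf K b k → A k w i = 0
  β_support : ∀ k i, i ∉ relaysOf K b k → β k i = 0
  V_A : ∀ k w, V (A k w) = w
  V_noise : ∀ s, V (∑ k, Φ s k • β k) = 0
  exists_noise : ∀ y, V y = 0 → ∃ s, ∑ k, Φ s k • β k = y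
  exists_relay_noise : ∀ i (t : Fin K → F), ∃ s, ∀ k ∈ usersOf K b i, Φ s k * β k i = t k

section

variable {K b : ℕ} {F : Type} [Field F]

/-- The last `b` coefficients of the polynomial of degree `< K` with values `y` at the nodes. -/
noncomputable def decoder (b : ℕ) (α : Fin K → F) : (Fin K → F) →ₗ[F] (Fin b → F) :=
  LinearMap.pi fun j => lcoeff F (K - b + j) ∘ₗ Lagrange.interpolate Finset.univ α

theorem decoder_eval {α : Fin K → F} (hα : Function.Injective α) {p : F[X]}
    (hp : p.degree < K) (j : Fin b) :
    decoder b α (fun i => p.eval (α i)) j = p.coeff (K - b + j) := by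
  have h := Lagrange.eq_interpolate (s := Finset.univ) (v := α) (f := p) hα.injOn (by simpa using hp)
  simp only [decoder, LinearMap.pi_apply, LinearMap.comp_apply, ← h, lcoeff_apply]

theorem exists_poly_of_decoder_eq_zero (hb : b ≤ K) {α : Fin K → F} (hα : Function.Injective α)
    {y : Fin K → F} (hy : decoder b α y = 0) :
    ∃ p : F[X], p.degree < (K - b : ℕ) ∧ ∀ i, p.eval (α i) = y i := by
  refine ⟨Lagrange.interpolate Finset.univ α y, ?_, fun i =>
    Lagrange.eval_interpolate_at_node _ hα.injOn (Finset.mem_univ i)⟩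
  have hd : (Lagrange.interpolate Finset.univ α y).degree < K := by
    simpa using Lagrange.degree_interpolate_lt (s := Finset.univ) (v := α) y hα.injOn
  rw [degree_lt_iff_coeff_zero] at hd ⊢
  intro n hn
  by_cases hnK : K ≤ n
  · exact hd n hnK
  · have := congrFun hy ⟨n - (K - b), by omega⟩
    simp only [decoder, LinearMap.pi_apply, LinearMap.comp_apply, lcoeff_apply, Pi.zero_apply]
      at this
    rwa [Nat.add_sub_cancel' hn] at this

theorem decoder_surjective (hb : b ≤ K) {α : Fin K → F} (hα : Function.Injective α) :
    Function.Surjective (decoder b α) := by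
  intro w
  let p : F[X] := ∑ j : Fin b, monomial (K - b + j) (w j)
  have hp : p.degree < K := by
    refine (degree_sum_le _ _).trans_lt ((Finset.sup_lt_iff (WithBot.bot_lt_coe K)).2 fun j _ => ?_)
    have hj : K - b + j < K := by omega
    exact (degree_monomial_le _ _).trans_lt (WithBot.coe_lt_coe.2 hj)
  refine ⟨fun i => p.eval (α i), funext fun j => ?_⟩
  rw [decoder_eval hα hp, finsetSum_coeff, Finset.sum_eq_single j]
  · rw [coeff_monomial, if_pos rfl]
  · intro l _ hl
    rw [coeff_monomial, if_neg]
    intro h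
    exact hl (Fin.ext (by omega))
  · simp

/-- Any preimage of w under the decoder can be corrected by a polynomial of degree < K - b,
invisible to the decoder, that matches it at the K - b nodes outside the relays of k. A linear right
inverse then exists. -/
theorem exists_encoder (hb : b ≤ K) {α : Fin K → F} (hα : Function.Injective α) (k : Fin K) :
    ∃ A : (Fin b → F) →ₗ[F] (Fin K → F), (∀ w i, i ∉ relaysOf K b k → A w i = 0) ∧
      ∀ w, decoder b α (A w) = w := by
  classical
  let S : Submodule F (Fin K → F) :=
    { carrier := {y | ∀ i, i ∉ relaysOf K b k → y i = 0}
      add_mem' := fun {x y} hx hy i hi => by simp [hx i hi, hy i hi]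
      zero_mem' := fun i _ => rfl
      smul_mem' := fun c x hx i hi => by simp [hx i hi] }
  have hsurj : LinearMap.range (decoder b α ∘ₗ S.subtype) = ⊤ := by
    rw [LinearMap.range_eq_top]
    intro w
    obtain ⟨y, hy⟩ := decoder_surjective hb hα w
    let p := Lagrange.interpolate (relaysOf K b k)ᶜ α y
    have hp : p.degree < (K - b : ℕ) := by
      have := Lagrange.degree_interpolate_lt (s := (relaysOf K b k)ᶜ) (v := α) y hα.injOn
      rwa [Finset.card_compl, card_relaysOf hb, Fintype.card_fin] at this
    refine ⟨⟨y - fun i => p.eval (α i), fun i hi => ?_⟩, ?_⟩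
    · have : p.eval (α i) = y i :=
        Lagrange.eval_interpolate_at_node y hα.injOn (Finset.mem_compl.2 hi)
      simp [this]
    · have hz : decoder b α (fun i => p.eval (α i)) = 0 := by
        funext j
        rw [decoder_eval hα (hp.trans_le (by exact_mod_cast Nat.sub_le _ _))]
        exact (degree_lt_iff_coeff_zero _ _).1 hp _ (by omega)
      change decoder b α (y - fun i => p.eval (α i)) = w
      rw [map_sub, hz, sub_zero, hy]
  obtain ⟨g, hg⟩ := LinearMap.exists_rightInverse_of_surjective _ hsurj
  exact ⟨S.subtype ∘ₗ g, fun w i hi => (g w).2 i hi, fun w => LinearMap.congr_fun hg w⟩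

/-- The constraint satisfied by the individual keys. -/
noncomputable def keyCheck (b : ℕ) {r : ℕ} (α : Fin K → F) (c : Fin K → degreeLT F r) :
    (Fin K → F) →ₗ[F] (Fin r → F) :=
  LinearMap.pi fun j => ∑ k, (keyPoly b α c k).coeff (K - b + j) • LinearMap.proj k

theorem keyCheck_apply {r : ℕ} (α : Fin K → F) (c : Fin K → degreeLT F r) (z : Fin K → F)
    (j : Fin r) : keyCheck b α c z j = (∑ k, C (z k) * keyPoly b α c k).coeff (K - b + j) := by
  simp [keyCheck, mul_comm]

/-- The users in the range of `κ` alone can give the key constraints any value. This yields both the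
dimension K - r of the key space and, with users outside a relay, relay security. -/
theorem exists_key_of_det_ne_zero {r : ℕ} {α : Fin K → F} {c : Fin K → degreeLT F r}
    {κ : Fin r → Fin K} (hκ : Function.Injective κ)
    (hdet : (Matrix.of fun l j : Fin r => (keyPoly b α c (κ l)).coeff (K - b + j)).det ≠ 0)
    (v : Fin r → F) : ∃ z, keyCheck b α c z = v ∧ ∀ k ∉ Set.range κ, z k = 0 := by
  obtain ⟨x, hx⟩ := (Matrix.vecMul_surjective_iff_isUnit.2
    ((Matrix.isUnit_iff_isUnit_det _).2 hdet.isUnit)) v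
  have h0 : ∀ k ∉ Set.range κ, Function.extend κ x 0 k = 0 := fun k hk =>
    Function.extend_apply' _ _ _ hk
  refine ⟨Function.extend κ x 0, ?_, h0⟩
  rw [← hx]
  funext j
  simp only [keyCheck, LinearMap.pi_apply, LinearMap.sum_apply, LinearMap.smul_apply,
    LinearMap.proj_apply, Matrix.vecMul, dotProduct, Matrix.of_apply, smul_eq_mul]
  symm
  refine Fintype.sum_of_injective κ hκ _ _ (fun k hk => by rw [h0 k hk, mul_zero]) fun l => ?_
  rw [hκ.extend_apply, mul_comm]

end

/-- With r = min(b, K-b): r ≤ b keeps the noise degrees below K, and r ≤ K - b leaves r users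
outside each relay. The admissible keys form the kernel of `keyCheck`, of dimension K - r. -/
theorem exists_linearCode {K b : ℕ} (hb : 1 ≤ b) (hbK : b < K) {F : Type} [Field F] [Fintype F]
    (hq : 2 * K * K + K < Fintype.card F) :
    Nonempty (LinearCode K b (K - min b (K - b)) F) := by
  classical
  obtain ⟨r, hr⟩ : ∃ r, r = min b (K - b) := ⟨_, rfl⟩
  rw [← hr]
  obtain ⟨α, hα⟩ : ∃ α : Fin K → F, Function.Injective α := by
    have : Nonempty (Fin K ↪ F) := Function.Embedding.nonempty_of_card_le (by simp; nlinarith)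
    exact ⟨this.some, this.some.injective⟩
  have hκ : ∀ i : Fin K, ∃ κ : Fin r → Fin K, Function.Injective κ ∧ ∀ l, κ l ∉ usersOf K b i := by
    intro i
    have hc : Fintype.card (Fin r) ≤ Fintype.card {k // k ∈ (usersOf K b i)ᶜ} := by
      rw [Fintype.card_coe, Finset.card_compl, card_usersOf hbK.le, Fintype.card_fin,
        Fintype.card_fin]
      omega
    obtain ⟨f⟩ := Function.Embedding.nonempty_of_card_le hc
    exact ⟨fun l => f l, Subtype.val_injective.comp f.injective, fun l =>
      Finset.mem_compl.1 (f l).2⟩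
  choose κ hκ hκ' using hκ
  have hm : K - b + r ≤ K := by omega
  obtain ⟨c, hc1, hc2, hc3⟩ := exists_generic hb hbK (r := r) (by omega) (by omega) hq hα κ hκ hm
  have hnode : ∀ k i, (keyPoly b α c k).eval (α i) = 0 ↔ i ∉ relaysOf K b k := by
    intro k i
    rw [keyPoly, eval_mul, mul_eq_zero, eval_annihilator_eq_zero_iff hα]
    simp [hc1 k i]
  have hTsurj : Function.Surjective (keyCheck b α c) := fun v =>
    let ⟨z, hz, _⟩ := exists_key_of_det_ne_zero (hκ ⟨0, by omega⟩) (hc2 ⟨0, by omega⟩) v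
    ⟨z, hz⟩
  have hfin : Module.finrank F (Fin (K - r) → F) =
      Module.finrank F (LinearMap.ker (keyCheck b α c)) := by
    have h := (keyCheck b α c).finrank_range_add_finrank_ker
    rw [LinearMap.range_eq_top.2 hTsurj, finrank_top, Module.finrank_fin_fun,
      Module.finrank_fin_fun] at h
    rw [Module.finrank_fin_fun]
    omega
  let e := LinearEquiv.ofFinrankEq _ _ hfin
  have hker : ∀ z, keyCheck b α c z = 0 →
      ∃ s, ((LinearMap.ker (keyCheck b α c)).subtype ∘ₗ e.toLinearMap) s = z := fun z hz =>
    ⟨e.symm ⟨z, hz⟩, by simp⟩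
  choose A hA hVA using fun k => exists_encoder hbK.le hα (b := b) k
  have hdeg : ∀ z : Fin K → F, (∑ k, C (z k) * keyPoly b α c k).degree < (K - b + r : ℕ) := by
    intro z
    refine (degree_sum_le _ _).trans_lt
      ((Finset.sup_lt_iff (WithBot.bot_lt_coe _)).2 fun k _ => ?_)
    refine (degree_mul_le _ _).trans_lt ?_
    refine lt_of_le_of_lt ?_ (degree_keyPoly_lt hbK.le α c k)
    exact add_le_of_nonpos_left degree_C_le
  have hnoise : ∀ z : Fin K → F, (∑ k, z k • fun i => (keyPoly b α c k).eval (α i)) =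
      fun i => (∑ k, C (z k) * keyPoly b α c k).eval (α i) := by
    intro z
    funext i
    simp [eval_finsetSum]
  refine ⟨⟨A, decoder b α, fun k i => (keyPoly b α c k).eval (α i),
    (LinearMap.ker (keyCheck b α c)).subtype ∘ₗ e.toLinearMap, hA,
    fun k i hi => (hnode k i).2 hi, hVA, fun s => ?_, fun y hy => ?_, fun i t => ?_⟩⟩
  · have hz : keyCheck b α c (e s : Fin K → F) = 0 := (e s).2
    change decoder b α (∑ k, (e s : Fin K → F) k • fun i => (keyPoly b α c k).eval (α i)) = 0
    rw [hnoise]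
    funext j
    rw [decoder_eval hα ((hdeg _).trans_le (by exact_mod_cast hm)), Pi.zero_apply]
    -- The first r decoded coefficients of the noise vanish by the key constraints, the others by
    -- degree.
    by_cases hj : (j : ℕ) < r
    · rw [← keyCheck_apply α c _ ⟨j, hj⟩, hz, Pi.zero_apply]
    · exact (degree_lt_iff_coeff_zero _ _).1 (hdeg _) _ (by omega)
  · obtain ⟨p, hp, hpy⟩ := exists_poly_of_decoder_eq_zero hbK.le hα hy
    obtain ⟨x, hx⟩ := (Matrix.vecMul_surjective_iff_isUnit.2
      ((Matrix.isUnit_iff_isUnit_det _).2 hc3.isUnit)) fun j => p.eval (α (Fin.castLE hm j))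
    -- Only the first K - b + r users receive nonzero keys; their noise polynomials span. Since p
    -- has degree < K - b, these keys satisfy the constraints automatically.
    let z : Fin K → F := Function.extend (Fin.castLE hm) x 0
    have hinj := Fin.castLE_injective hm
    have hz : ∑ k, C (z k) * keyPoly b α c k = p := by
      refine eq_of_degrees_lt_of_eval_index_eq (s := Finset.univ)
        (v := fun j : Fin (K - b + r) => α (Fin.castLE hm j)) (hα.comp hinj).injOn
        (by simpa using hdeg z)
        (by simpa using hp.trans_le (by exact_mod_cast Nat.le_add_right _ _)) fun j _ => ?_
      have := congrFun hx j
      simp only [Matrix.vecMul, dotProduct, Matrix.of_apply] at this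
      rw [← this, eval_finsetSum]
      symm
      refine Fintype.sum_of_injective _ hinj _ _ (fun k hk => ?_) fun l => ?_
      · have : z k = 0 := Function.extend_apply' _ _ _ hk
        rw [this, C_0, zero_mul, eval_zero]
      · have : z (Fin.castLE hm l) = x l := hinj.extend_apply _ _ _
        rw [this, eval_mul, eval_C]
    obtain ⟨s, hs⟩ := hker z (by
      funext j
      rw [keyCheck_apply, hz]
      exact (degree_lt_iff_coeff_zero _ _).1 hp _ (by omega))
    refine ⟨s, ?_⟩
    rw [hs, hnoise, hz]
    exact funext hpy
  -- `z₀` prescribes the keys of the users of relay i; `z₁`, supported on users outside the relay,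
  -- repairs the constraints.
  · let z₀ : Fin K → F := fun k =>
      if k ∈ usersOf K b i then t k / (keyPoly b α c k).eval (α i) else 0
    obtain ⟨z₁, hz₁, hz₁'⟩ := exists_key_of_det_ne_zero (hκ i) (hc2 i) (-keyCheck b α c z₀)
    obtain ⟨s, hs⟩ := hker (z₀ + z₁) (by rw [map_add, hz₁, add_neg_cancel])
    refine ⟨s, fun k hk => ?_⟩
    have h1 : z₁ k = 0 := hz₁' k (by
      rintro ⟨l, rfl⟩
      exact hκ' i l hk)
    have h2 : (keyPoly b α c k).eval (α i) ≠ 0 := by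
      rw [Ne, hnode, not_not]
      exact mem_usersOf.1 hk
    rw [hs, Pi.add_apply, h1, add_zero]
    simp only [z₀, if_pos hk]
    exact div_mul_cancel₀ _ h2

/-! ### Entropy of additive maps under the uniform distribution -/

section Uniform

variable {Ω S T U : Type}

theorem isRandomVar_of_discrete [MeasurableSpace Ω] [DiscreteMeasurableSpace Ω] (X : Ω → S) :
    IsRandomVar X := fun _ => .of_discrete

theorem map_zero_of_additive [AddCommGroup Ω] [AddCommGroup S] {X : Ω → S} (hX : ∀ a b, X (a + b) = X a + X b) : X 0 = 0 :=
  (AddMonoidHom.mk' X hX).map_zero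

theorem map_sub_of_additive [AddCommGroup Ω] [AddCommGroup S] {X : Ω → S} (hX : ∀ a b, X (a + b) = X a + X b) (a b : Ω) :
    X (a - b) = X a - X b :=
  (AddMonoidHom.mk' X hX).map_sub a b

variable [Fintype Ω]

/-- The uniform distribution on a finite type. -/
noncomputable def uniform (Ω : Type) [Fintype Ω] [Nonempty Ω] [MeasurableSpace Ω] : Measure Ω :=
  (PMF.uniformOfFintype Ω).toMeasure

instance [Nonempty Ω] [MeasurableSpace Ω] : IsProbabilityMeasure (uniform Ω) :=
  inferInstanceAs (IsProbabilityMeasure (PMF.uniformOfFintype Ω).toMeasure)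

open scoped Classical in
/-- The number of zeros of a function. -/
noncomputable def kerCard [Zero S] (X : Ω → S) : ℕ := (Finset.univ.filter fun ω => X ω = 0).card

theorem kerCard_congr [Zero S] [Zero T] {X : Ω → S} {Y : Ω → T} (h : ∀ ω, X ω = 0 ↔ Y ω = 0) :
    kerCard X = kerCard Y := by
  unfold kerCard
  congr 1
  ext ω
  simp [h ω]

section Additive

variable [AddCommGroup Ω] [AddCommGroup S] [AddCommGroup T] [AddCommGroup U]

theorem kerCard_pos {X : Ω → S} (hX : ∀ a b, X (a + b) = X a + X b) : 0 < kerCard X :=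
  Finset.card_pos.2 ⟨0, by simpa using map_zero_of_additive hX⟩

/-- Fibres of an additive map are cosets of its kernel, so entropies reduce to kernel sizes. -/
theorem fiberCard_eq_kerCard {X : Ω → S} (hX : ∀ a b, X (a + b) = X a + X b) (ω : Ω) :
    fiberCard X ω = kerCard X := by
  unfold fiberCard kerCard
  refine Finset.card_bij (fun a _ => a - ω) (fun a ha => ?_) (fun a _ b _ h => sub_left_injective h)
    fun b hb => ⟨b + ω, ?_, by simp⟩
  · simp only [Finset.mem_filter, Finset.mem_univ, true_and] at ha ⊢
    rw [map_sub_of_additive hX, ha, sub_self]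
  · simp only [Finset.mem_filter, Finset.mem_univ, true_and] at hb ⊢
    rw [hX, hb, zero_add]

/-- The zeros of `X`, counted by the values of a second additive map. -/
theorem kerCard_eq_mul_ncard {X : Ω → S} {Y : Ω → T} (hX : ∀ a b, X (a + b) = X a + X b)
    (hY : ∀ a b, Y (a + b) = Y a + Y b) :
    kerCard X = kerCard (fun ω => (X ω, Y ω)) * (Y '' {ω | X ω = 0}).ncard := by
  classical
  have h1 : (Y '' {ω | X ω = 0}).ncard = ((Finset.univ.filter fun ω => X ω = 0).image Y).card := by
    rw [← Set.ncard_coe_finset]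
    congr 1
    simp
  rw [h1]
  have h2 := Finset.card_eq_sum_card_image Y (Finset.univ.filter fun ω => X ω = 0)
  have h3 : ∀ m ∈ (Finset.univ.filter fun ω => X ω = 0).image Y,
      ((Finset.univ.filter fun ω => X ω = 0).filter fun ω => Y ω = m).card =
      kerCard fun ω => (X ω, Y ω) := by
    intro m hm
    obtain ⟨ω₀, h0, rfl⟩ := Finset.mem_image.1 hm
    simp only [Finset.mem_filter, Finset.mem_univ, true_and] at h0
    rw [← fiberCard_eq_kerCard (fun a b => by rw [hX, hY]; rfl) ω₀]
    unfold fiberCard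
    congr 1
    ext ω
    simp [h0]
  rw [Finset.sum_congr rfl h3, Finset.sum_const, smul_eq_mul, mul_comm] at h2
  rw [← h2]
  unfold kerCard
  congr

end Additive

variable [Nonempty Ω] [MeasurableSpace Ω] [DiscreteMeasurableSpace Ω]

open scoped Classical in
theorem prob_uniform (X : Ω → S) (s : S) : prob (uniform Ω) X s =
    ((Finset.univ.filter fun ω => X ω = s).card : ℝ) / Fintype.card Ω := by
  unfold prob uniform
  rw [measureReal_def, PMF.toMeasure_uniformOfFintype_apply _ .of_discrete]
  rw [ENNReal.toReal_div, ENNReal.toReal_natCast, ENNReal.toReal_natCast]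
  congr 2
  rw [Fintype.card_subtype]
  congr

theorem sum_prob_mul [Fintype S] (X : Ω → S) (g : S → ℝ) :
    ∑ s, prob (uniform Ω) X s * g s = (∑ ω, g (X ω)) / Fintype.card Ω := by
  classical
  have h : ∀ s, prob (uniform Ω) X s * g s =
      (∑ ω, if X ω = s then g s else 0) / Fintype.card Ω := by
    intro s
    rw [prob_uniform, ← Finset.sum_filter, Finset.sum_const, nsmul_eq_mul, div_mul_eq_mul_div]
  rw [Finset.sum_congr rfl fun s _ => h s, ← Finset.sum_div, Finset.sum_comm]
  simp

theorem prob_uniform_self (X : Ω → S) (ω : Ω) :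
    prob (uniform Ω) X (X ω) = (fiberCard X ω : ℝ) / Fintype.card Ω := prob_uniform X _

variable [AddCommGroup Ω] [AddCommGroup S] [AddCommGroup T] [AddCommGroup U]
  [Fintype S] [Fintype T] [Fintype U]

theorem entropy_uniform (q : ℕ) {X : Ω → S} (hX : ∀ a b, X (a + b) = X a + X b) :
    entropy q (uniform Ω) X = -Real.logb q ((kerCard X : ℝ) / Fintype.card Ω) := by
  unfold entropy
  rw [sum_prob_mul X fun s => Real.logb q (prob (uniform Ω) X s)]
  simp only [prob_uniform_self, fiberCard_eq_kerCard hX, Finset.sum_const, Finset.card_univ,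
    nsmul_eq_mul]
  rw [mul_div_cancel_left₀]
  exact_mod_cast Fintype.card_ne_zero

theorem condEntropy_uniform (q : ℕ) {X : Ω → S} {Y : Ω → T}
    (hX : ∀ a b, X (a + b) = X a + X b) (hY : ∀ a b, Y (a + b) = Y a + Y b) :
    condEntropy q (uniform Ω) X Y =
      -Real.logb q ((kerCard (fun ω => (X ω, Y ω)) : ℝ) / kerCard Y) := by
  have hXY : ∀ a b, (fun ω => (X ω, Y ω)) (a + b) =
      (fun ω => (X ω, Y ω)) a + (fun ω => (X ω, Y ω)) b := fun a b => by simp [hX, hY]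
  have hΩ : (Fintype.card Ω : ℝ) ≠ 0 := by exact_mod_cast Fintype.card_ne_zero
  have h1 : (0 : ℝ) < kerCard fun ω => (X ω, Y ω) := by exact_mod_cast kerCard_pos hXY
  have h2 : (0 : ℝ) < kerCard Y := by exact_mod_cast kerCard_pos hY
  rw [condEntropy_eq_sub q (isRandomVar_of_discrete X) (isRandomVar_of_discrete Y),
    entropy_uniform q hXY, entropy_uniform q hY, Real.logb_div h1.ne' hΩ, Real.logb_div h2.ne' hΩ,
    Real.logb_div h1.ne' h2.ne']
  ring

theorem condEntropy_uniform_eq_zero (q : ℕ) {X : Ω → S} {Y : Ω → T}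
    (hX : ∀ a b, X (a + b) = X a + X b) (hY : ∀ a b, Y (a + b) = Y a + Y b)
    (h : ∀ ω, Y ω = 0 → X ω = 0) : condEntropy q (uniform Ω) X Y = 0 := by
  have h2 : (kerCard Y : ℝ) ≠ 0 := by exact_mod_cast (kerCard_pos hY).ne'
  rw [condEntropy_uniform q hX hY, kerCard_congr (Y := Y) fun ω => by
    simp only [Prod.mk_eq_zero]; exact ⟨fun h => h.2, fun hω => ⟨h ω hω, hω⟩⟩, div_self h2,
    Real.logb_one, neg_zero]

/-- By additivity it is enough to test the observation X = 0 and V = 0: if every Y-value possible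
with V = 0 remains possible there, both conditional entropies are logarithms of the same index. -/
theorem condMutualInfo_uniform_eq_zero (q : ℕ) {X : Ω → S} {Y : Ω → T} {V : Ω → U}
    (hX : ∀ a b, X (a + b) = X a + X b) (hY : ∀ a b, Y (a + b) = Y a + Y b)
    (hV : ∀ a b, V (a + b) = V a + V b)
    (h : ∀ ω, V ω = 0 → ∃ ω', X ω' = 0 ∧ V ω' = 0 ∧ Y ω' = Y ω) :
    condMutualInfo q (uniform Ω) X Y V = 0 := by
  have hXV : ∀ a b, (fun ω => (X ω, V ω)) (a + b) =
      (fun ω => (X ω, V ω)) a + (fun ω => (X ω, V ω)) b := fun a b => by simp [hX, hV]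
  have hYV : ∀ a b, (fun ω => (Y ω, V ω)) (a + b) =
      (fun ω => (Y ω, V ω)) a + (fun ω => (Y ω, V ω)) b := fun a b => by simp [hY, hV]
  have h1 := kerCard_eq_mul_ncard (X := fun ω => (X ω, V ω)) hXV hY
  have h2 := kerCard_eq_mul_ncard hV hY
  have himg : Y '' {ω | (X ω, V ω) = 0} = Y '' {ω | V ω = 0} := by
    ext y
    simp only [Set.mem_image, Set.mem_ofPred_eq, Prod.mk_eq_zero]
    constructor
    · rintro ⟨ω, hω, rfl⟩; exact ⟨ω, hω.2, rfl⟩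
    · rintro ⟨ω, hω, rfl⟩
      obtain ⟨ω', a, b, c⟩ := h ω hω
      exact ⟨ω', ⟨a, b⟩, c⟩
  rw [himg] at h1
  have e1 : kerCard (fun ω => ((X ω, V ω), Y ω)) = kerCard fun ω => (X ω, Y ω, V ω) :=
    kerCard_congr fun ω => by simp only [Prod.mk_eq_zero]; tauto
  have e2 : kerCard (fun ω => (V ω, Y ω)) = kerCard fun ω => (Y ω, V ω) :=
    kerCard_congr fun ω => by simp only [Prod.mk_eq_zero]; tauto
  rw [e1] at h1
  rw [e2] at h2
  have hI : (Y '' {ω | V ω = 0}).ncard ≠ 0 := by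
    intro h0
    rw [h0, mul_zero] at h2
    exact (kerCard_pos hV).ne' h2
  unfold condMutualInfo
  rw [condEntropy_uniform q hX hV, condEntropy_uniform q hX hYV, h1, h2]
  push_cast
  rw [mul_div_mul_right _ _ (by exact_mod_cast hI), sub_self]

theorem mutualInfo_uniform_eq_zero (q : ℕ) {X : Ω → S} {Y : Ω → T}
    (hX : ∀ a b, X (a + b) = X a + X b) (hY : ∀ a b, Y (a + b) = Y a + Y b)
    (h : ∀ ω, ∃ ω', X ω' = 0 ∧ Y ω' = Y ω) : mutualInfo q (uniform Ω) X Y = 0 := by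
  have h1 := kerCard_eq_mul_ncard hX hY
  -- The zero map into a trivial group has all of Ω as kernel, which turns the formula into |Ω| =
  -- |ker Y| · |im Y|.
  have h2 := kerCard_eq_mul_ncard (X := fun _ : Ω => (0 : ZMod 1)) (fun _ _ => rfl) hY
  have himg : Y '' {ω | X ω = 0} = Y '' {ω | (0 : ZMod 1) = 0} := by
    ext y
    simp only [Set.mem_image, Set.mem_ofPred_eq]
    constructor
    · rintro ⟨ω, hω, rfl⟩; exact ⟨ω, trivial, rfl⟩
    · rintro ⟨ω, -, rfl⟩
      obtain ⟨ω', a, b⟩ := h ω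
      exact ⟨ω', a, b⟩
  rw [himg] at h1
  have e0 : kerCard (fun _ : Ω => (0 : ZMod 1)) = Fintype.card Ω := by
    simp [kerCard]
  have e2 : kerCard (fun ω => ((0 : ZMod 1), Y ω)) = kerCard Y :=
    kerCard_congr fun ω => by simp only [Prod.mk_eq_zero]; tauto
  rw [e0, e2] at h2
  have hI : (Y '' {ω | (0 : ZMod 1) = 0}).ncard ≠ 0 := by
    intro h0
    rw [h0, mul_zero] at h2
    exact Fintype.card_ne_zero h2
  unfold mutualInfo
  rw [condEntropy_uniform q hX hY, entropy_uniform q hX, h1, h2]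
  push_cast
  rw [mul_div_mul_right _ _ (by exact_mod_cast hI), sub_self]

/-- If `X` is surjective on the zeros of `Y`, then `X` is uniform and independent of `Y`. -/
theorem entropy_pair_uniform (q : ℕ) {X : Ω → S} {Y : Ω → T}
    (hX : ∀ a b, X (a + b) = X a + X b) (hY : ∀ a b, Y (a + b) = Y a + Y b)
    (h : ∀ x, ∃ ω, Y ω = 0 ∧ X ω = x) : entropy q (uniform Ω) (fun ω => (X ω, Y ω)) =
      Real.logb q (Fintype.card S) + entropy q (uniform Ω) Y := by
  have h1 := kerCard_eq_mul_ncard hY hX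
  have himg : X '' {ω | Y ω = 0} = Set.univ := Set.eq_univ_of_forall h
  have e1 : kerCard (fun ω => (Y ω, X ω)) = kerCard fun ω => (X ω, Y ω) :=
    kerCard_congr fun ω => by simp only [Prod.mk_eq_zero]; tauto
  rw [himg, e1, Set.ncard_univ, Nat.card_eq_fintype_card] at h1
  have hXY : ∀ a b, (fun ω => (X ω, Y ω)) (a + b) =
      (fun ω => (X ω, Y ω)) a + (fun ω => (X ω, Y ω)) b := fun a b => by simp [hX, hY]
  have hΩ : (Fintype.card Ω : ℝ) ≠ 0 := by exact_mod_cast Fintype.card_ne_zero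
  have hS : (Fintype.card S : ℝ) ≠ 0 := by exact_mod_cast Fintype.card_ne_zero
  have h2 : (kerCard fun ω => (X ω, Y ω) : ℝ) ≠ 0 := by exact_mod_cast (kerCard_pos hXY).ne'
  rw [entropy_uniform q hXY, entropy_uniform q hY, h1]
  push_cast
  rw [Real.logb_div h2 hΩ, Real.logb_div (mul_ne_zero h2 hS) hΩ, Real.logb_mul h2 hS]
  ring

theorem entropy_uniform_of_surjective (q : ℕ) {X : Ω → S}
    (hX : ∀ a b, X (a + b) = X a + X b) (h : Function.Surjective X) :
    entropy q (uniform Ω) X = Real.logb q (Fintype.card S) := by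
  have h1 := kerCard_eq_mul_ncard (X := fun _ : Ω => (0 : ZMod 1)) (fun _ _ => rfl) hX
  have himg : X '' {ω | (0 : ZMod 1) = 0} = Set.univ :=
    Set.eq_univ_of_forall fun x => let ⟨ω, hω⟩ := h x; ⟨ω, rfl, hω⟩
  have e0 : kerCard (fun _ : Ω => (0 : ZMod 1)) = Fintype.card Ω := by
    simp [kerCard]
  have e2 : kerCard (fun ω => ((0 : ZMod 1), X ω)) = kerCard X :=
    kerCard_congr fun ω => by simp only [Prod.mk_eq_zero]; tauto
  rw [e0, e2, himg, Set.ncard_univ, Nat.card_eq_fintype_card] at h1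
  have hS : (Fintype.card S : ℝ) ≠ 0 := by exact_mod_cast Fintype.card_ne_zero
  have h2 : (kerCard X : ℝ) ≠ 0 := by exact_mod_cast (kerCard_pos hX).ne'
  rw [entropy_uniform q hX, h1]
  push_cast
  rw [Real.logb_div h2 (mul_ne_zero h2 hS), Real.logb_mul h2 hS]
  ring

end Uniform

/-! ### From a linear code to a scheme -/

section Pad

variable {F : Type} [AddCommGroup F]

/-- Truncate a word or extend it by zeros to length `N`. -/
def pad {n : ℕ} (N : ℕ) (x : Fin n → F) : Fin N → F :=
  fun j => if h : (j : ℕ) < n then x ⟨j, h⟩ else 0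

theorem pad_add {n N : ℕ} (x y : Fin n → F) : pad N (x + y) = pad N x + pad N y := by
  funext j
  by_cases h : (j : ℕ) < n <;> simp [pad, h]

theorem pad_zero {n N : ℕ} : pad N (0 : Fin n → F) = 0 := by
  funext j
  simp [pad]

theorem eq_zero_of_pad_eq_zero {n N : ℕ} (h : n ≤ N) {x : Fin n → F} (hx : pad N x = 0) :
    x = 0 := by
  funext j
  have := congrFun hx ⟨j, j.2.trans_le h⟩
  simpa [pad] using this

end Pad

theorem relaysOf_mono {K b B : ℕ} (h : b ≤ B) (k : Fin K) : relaysOf K b k ⊆ relaysOf K B k :=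
  fun i hi => by simp [relaysOf] at hi ⊢; omega

namespace LinearCode

variable {K b d : ℕ} {F : Type} [Field F] (c : LinearCode K b d F)
variable {n L M : ℕ} (e : Fin n × Fin b ≃ Fin L) (e' : Fin n × Fin d ↪ Fin M)

/-- The individual key symbols of user `k`, one for each block. -/
def key (s : Fin M → F) (k : Fin K) : Fin n → F := fun a => c.Φ (fun j => s (e' (a, j))) k

/-- The symbols sent by user `k` to relay `i`, one for each block. -/
def userMsg (w : Fin K → Fin L → F) (s : Fin M → F) (k i : Fin K) : Fin n → F :=
  fun a => c.A k (fun j => w k (e (a, j))) i + c.key e' s k a * c.β k i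

/-- The symbols sent by relay `i`, one for each block. -/
def relayMsg (w : Fin K → Fin L → F) (s : Fin M → F) (i : Fin K) : Fin n → F :=
  ∑ k, c.userMsg e e' w s k i

theorem key_add (s s' : Fin M → F) (k : Fin K) :
    c.key e' (s + s') k = c.key e' s k + c.key e' s' k := by
  funext a
  exact congrFun (c.Φ.map_add (fun j => s (e' (a, j))) fun j => s' (e' (a, j))) k

theorem key_zero (k : Fin K) : c.key e' 0 k = 0 := by
  simpa using c.key_add e' 0 0 k

theorem userMsg_add (w w' : Fin K → Fin L → F) (s s' : Fin M → F) (k i : Fin K) :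
    c.userMsg e e' (w + w') (s + s') k i = c.userMsg e e' w s k i + c.userMsg e e' w' s' k i := by
  funext a
  have h : c.A k (fun j => (w + w') k (e (a, j))) i =
      c.A k (fun j => w k (e (a, j))) i + c.A k (fun j => w' k (e (a, j))) i :=
    congrFun ((c.A k).map_add (fun j => w k (e (a, j))) fun j => w' k (e (a, j))) i
  simp only [userMsg, Pi.add_apply] at h ⊢
  rw [h, key_add, Pi.add_apply]
  ring

theorem relayMsg_add (w w' : Fin K → Fin L → F) (s s' : Fin M → F) (i : Fin K) :
    c.relayMsg e e' (w + w') (s + s') i = c.relayMsg e e' w s i + c.relayMsg e e' w' s' i := by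
  simp only [relayMsg, userMsg_add, Finset.sum_add_distrib]

theorem userMsg_eq_zero {w : Fin K → Fin L → F} {s : Fin M → F} {k : Fin K} (hw : w k = 0)
    (hz : c.key e' s k = 0) (i : Fin K) : c.userMsg e e' w s k i = 0 := by
  funext a
  have : (fun j => w k (e (a, j))) = (0 : Fin b → F) := by rw [hw]; rfl
  simp [userMsg, this, hz]

theorem userMsg_eq_zero_of_notMem (w : Fin K → Fin L → F) (s : Fin M → F) {k i : Fin K}
    (hi : i ∉ relaysOf K b k) : c.userMsg e e' w s k i = 0 := by
  funext a
  simp [userMsg, c.A_support k _ i hi, c.β_support k i hi]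

theorem decode_relayMsg (w : Fin K → Fin L → F) (s : Fin M → F) (a : Fin n) :
    c.V (fun i => c.relayMsg e e' w s i a) = fun j => (∑ k, w k) (e (a, j)) := by
  have h : (fun i => c.relayMsg e e' w s i a) =
      ∑ k, c.A k (fun j => w k (e (a, j))) + ∑ k, c.key e' s k a • c.β k := by
    funext i
    simp [relayMsg, userMsg, Finset.sum_add_distrib]
  rw [h, map_add, map_sum]
  have h2 := c.V_noise fun j => s (e' (a, j))
  simp only [key, h2, add_zero, c.V_A]
  funext j
  simp

/-- The encoded inputs add up to a vector in the kernel of the decoder, and the noise covers that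
kernel, so it can cancel them. This is server security. -/
theorem exists_relayMsg_eq_zero {w : Fin K → Fin L → F} (hw : ∑ k, w k = 0) :
    ∃ s : Fin M → F, ∀ i, c.relayMsg e e' w s i = 0 := by
  have h : ∀ a, ∃ t, ∑ k, c.Φ t k • c.β k = -∑ k, c.A k (fun j => w k (e (a, j))) := by
    intro a
    refine c.exists_noise _ ?_
    rw [map_neg, map_sum]
    simp only [c.V_A]
    rw [neg_eq_zero]
    funext j
    simpa using congrFun hw (e (a, j))
  choose t ht using h
  refine ⟨Function.extend e' (fun p => t p.1 p.2) 0, fun i => funext fun a => ?_⟩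
  have h2 := congrFun (ht a) i
  simp only [Finset.sum_apply, Pi.smul_apply, Pi.neg_apply, smul_eq_mul] at h2
  simp [relayMsg, userMsg, key, e'.injective.extend_apply, Finset.sum_add_distrib, h2]

/-- The keys of the users of relay i are free, so each can cancel the input part of its own message.
This is relay security. -/
theorem exists_userMsg_eq_zero (w : Fin K → Fin L → F) (i : Fin K) :
    ∃ s : Fin M → F, ∀ k, c.userMsg e e' w s k i = 0 := by
  choose t ht using fun a => c.exists_relay_noise i fun k => -c.A k (fun j => w k (e (a, j))) i
  refine ⟨Function.extend e' (fun p => t p.1 p.2) 0, fun k => ?_⟩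
  by_cases hi : i ∈ relaysOf K b k
  · funext a
    have h2 := ht a k (mem_usersOf.2 hi)
    simp [userMsg, key, e'.injective.extend_apply, h2]
  · exact c.userMsg_eq_zero_of_notMem e e' _ _ hi

variable {B : ℕ} [Fintype F]

/-- The scheme that applies a linear code to each of `n` blocks and pads all words by zeros. -/
noncomputable def toScheme (hbB : b ≤ B) (hL : 0 < L) (LX : Fin K → Fin K → ℕ) (LXtot : ℕ)
    (LX_sum : ∀ k, ∑ i ∈ relaysOf K B k, LX k i = LXtot) (LY : Fin K → ℕ) (LZ : ℕ)
    (hLX : ∀ k, ∀ i ∈ relaysOf K b k, n ≤ LX k i) (hLY : ∀ i, n ≤ LY i) (hLZ : n ≤ LZ) :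
    Scheme K B F :=
  letI : MeasurableSpace ((Fin K → Fin L → F) × (Fin M → F)) := ⊤
  haveI : DiscreteMeasurableSpace ((Fin K → Fin L → F) × (Fin M → F)) := ⟨fun _ => trivial⟩
  have hq : (1 : ℝ) < Fintype.card F := by exact_mod_cast Fintype.one_lt_card (α := F)
  have hlogW : ∀ m : ℕ, Real.logb (Fintype.card F) (Fintype.card (Fin m → F)) = m := fun m => by
    rw [Fintype.card_fun, Fintype.card_fin, Nat.cast_pow, Real.logb_pow,
      Real.logb_self_eq_one hq, mul_one]
  have hXadd : ∀ k i (x y : (Fin K → Fin L → F) × (Fin M → F)),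
      pad (LX k i) (c.userMsg e e' (x + y).1 (x + y).2 k i) =
      pad (LX k i) (c.userMsg e e' x.1 x.2 k i) + pad (LX k i) (c.userMsg e e' y.1 y.2 k i) :=
    fun k i x y => by rw [Prod.fst_add, Prod.snd_add, userMsg_add, pad_add]
  have hYadd : ∀ i (x y : (Fin K → Fin L → F) × (Fin M → F)),
      pad (LY i) (c.relayMsg e e' (x + y).1 (x + y).2 i) =
      pad (LY i) (c.relayMsg e e' x.1 x.2 i) + pad (LY i) (c.relayMsg e e' y.1 y.2 i) :=
    fun i x y => by rw [Prod.fst_add, Prod.snd_add, relayMsg_add, pad_add]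
  have hZadd : ∀ k (x y : (Fin K → Fin L → F) × (Fin M → F)),
      pad LZ (c.key e' (x + y).2 k) = pad LZ (c.key e' x.2 k) + pad LZ (c.key e' y.2 k) :=
    fun k x y => by rw [Prod.snd_add, key_add, pad_add]
  have hWent : ∀ k, entropy (Fintype.card F) (uniform ((Fin K → Fin L → F) × (Fin M → F)))
      (fun ω => ω.1 k) = L := fun k => by
    rw [entropy_uniform_of_surjective _ (fun _ _ => rfl) fun x => ⟨(fun _ => x, 0), rfl⟩, hlogW]
  have hWcard : Real.logb (Fintype.card F) (Fintype.card (Fin K → Fin L → F)) =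
      ∑ k : Fin K, entropy (Fintype.card F) (uniform ((Fin K → Fin L → F) × (Fin M → F)))
      (fun ω => ω.1 k) := by
    simp only [hWent]
    rw [Fintype.card_fun, Nat.cast_pow, Real.logb_pow, hlogW]
    simp
  { Ω := (Fin K → Fin L → F) × (Fin M → F)
    μ := uniform _
    L := L
    L_pos := hL
    LX := LX
    LXtot := LXtot
    LX_sum := LX_sum
    LY := LY
    LZ := LZ
    LS := M
    W := fun k ω => ω.1 k
    Z := fun k ω => pad LZ (c.key e' ω.2 k)
    S := fun ω => ω.2
    X := fun k i ω => pad (LX k i) (c.userMsg e e' ω.1 ω.2 k i)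
    Y := fun i ω => pad (LY i) (c.relayMsg e e' ω.1 ω.2 i)
    W_rv := fun _ => isRandomVar_of_discrete _
    Z_rv := fun _ => isRandomVar_of_discrete _
    S_rv := isRandomVar_of_discrete _
    X_rv := fun _ _ => isRandomVar_of_discrete _
    Y_rv := fun _ => isRandomVar_of_discrete _
    input_uniform := hWent
    input_indep := by
      rw [← hWcard]
      exact entropy_uniform_of_surjective _ (fun _ _ => rfl) fun x => ⟨(x, 0), rfl⟩
    key_gen := by
      refine condEntropy_uniform_eq_zero _ (fun x y => funext fun k => hZadd k x y)
        (fun _ _ => rfl) fun ω hω => funext fun k => ?_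
      rw [hω, key_zero, pad_zero]
      rfl
    key_input_indep := by
      rw [← hWcard]
      refine entropy_pair_uniform _
        (X := fun (ω : (Fin K → Fin L → F) × (Fin M → F)) k => ω.1 k)
        (Y := fun (ω : (Fin K → Fin L → F) × (Fin M → F)) k => pad LZ (c.key e' ω.2 k))
        (fun _ _ => rfl) (fun x y => funext fun k => hZadd k x y)
        fun x => ⟨(x, 0), funext fun k => ?_, rfl⟩
      change pad LZ (c.key e' 0 k) = 0
      rw [key_zero, pad_zero]
    user_encode := fun k => by
      refine condEntropy_uniform_eq_zero _ (fun x y => funext fun i => hXadd k i x y)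
        (fun x y => Prod.ext rfl (hZadd k x y)) fun ω hω => funext fun i => ?_
      rw [Prod.mk_eq_zero] at hω
      rw [c.userMsg_eq_zero e e' hω.1 (eq_zero_of_pad_eq_zero hLZ hω.2), pad_zero]
      rfl
    relay_encode := fun i => by
      refine condEntropy_uniform_eq_zero _ (hYadd i) (fun x y => funext fun k => hXadd k i x y)
        fun ω hω => ?_
      have h0 : c.relayMsg e e' ω.1 ω.2 i = 0 := by
        refine Finset.sum_eq_zero fun k _ => ?_
        by_cases hi : i ∈ relaysOf K b k
        · exact eq_zero_of_pad_eq_zero (hLX k i hi)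
            (congrFun hω ⟨k, mem_usersOf.2 (relaysOf_mono hbB k hi)⟩)
        · exact c.userMsg_eq_zero_of_notMem e e' _ _ hi
      rw [h0, pad_zero]
    recovery := by
      refine condEntropy_uniform_eq_zero _ (fun x y => Finset.sum_add_distrib)
        (fun x y => funext fun i => hYadd i x y) fun ω hω => ?_
      have h0 : ∀ i, c.relayMsg e e' ω.1 ω.2 i = 0 := fun i =>
        eq_zero_of_pad_eq_zero (hLY i) (congrFun hω i)
      funext l
      obtain ⟨⟨a, j⟩, rfl⟩ := e.surjective l
      have h := congrFun (c.decode_relayMsg e e' ω.1 ω.2 a) j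
      rw [← h]
      simp only [h0]
      exact congrFun (map_zero c.V) j
    server_security := by
      refine condMutualInfo_uniform_eq_zero _ (fun x y => funext fun i => hYadd i x y)
        (fun _ _ => rfl) (fun x y => Finset.sum_add_distrib) fun ω hω => ?_
      obtain ⟨s, hs⟩ := c.exists_relayMsg_eq_zero e e' hω
      refine ⟨(ω.1, s), funext fun i => ?_, hω, rfl⟩
      change pad (LY i) (c.relayMsg e e' ω.1 s i) = 0
      rw [hs, pad_zero]
    relay_security := fun i => by
      refine mutualInfo_uniform_eq_zero _
        (X := fun (ω : (Fin K → Fin L → F) × (Fin M → F)) (k : {k // k ∈ usersOf K B i}) =>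
          pad (LX k i) (c.userMsg e e' ω.1 ω.2 k i))
        (Y := fun (ω : (Fin K → Fin L → F) × (Fin M → F)) k => ω.1 k)
        (fun x y => funext fun k => hXadd k i x y) (fun _ _ => rfl) fun ω => ?_
      obtain ⟨s, hs⟩ := c.exists_userMsg_eq_zero e e' ω.1 i
      refine ⟨(ω.1, s), funext fun k => ?_, rfl⟩
      change pad (LX k i) (c.userMsg e e' ω.1 s k i) = 0
      rw [hs, pad_zero] }

end LinearCode

/-! ### Achievable rates and the optimal region -/

section Region

variable {K b B d : ℕ} {F : Type} [Field F] [Fintype F]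

/-- The surpluses `dX`, `dY`, `dZ` are zero padding and `dS` counts unused source symbols, so each
rate can be raised separately. -/
theorem LinearCode.exists_scheme (c : LinearCode K b d F) (hb : 1 ≤ b) (hbB : b ≤ B) (hBK : B ≤ K)
    {n : ℕ} (hn : 1 ≤ n) (dX dY dZ dS : ℕ) :
    ∃ s : Scheme K B F, s.rates = (((n * b + dX : ℕ) : ℝ) / (n * b : ℕ),
      ((K * n + dY : ℕ) : ℝ) / (K * (n * b : ℕ)), ((n + dZ : ℕ) : ℝ) / (n * b : ℕ),
      ((n * d + dS : ℕ) : ℝ) / (n * b : ℕ)) := by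
  classical
  have hK : 0 < K := by omega
  let i₀ : Fin K := ⟨0, hK⟩
  -- The surplus of user k goes to relay k, which always serves it; links to relays that only the
  -- larger association B allows carry nothing else.
  let LX : Fin K → Fin K → ℕ := fun k i =>
    (if i ∈ relaysOf K b k then n else 0) + if i = k then dX else 0
  let LY : Fin K → ℕ := fun i => n + if i = i₀ then dY else 0
  have hLX : ∀ k, ∑ i ∈ relaysOf K B k, LX k i = n * b + dX := by
    intro k
    simp only [LX]
    rw [Finset.sum_add_distrib, Finset.sum_ite_mem, Finset.sum_ite_eq',
      if_pos (mem_relaysOf_self (hb.trans hbB) k),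
      Finset.inter_eq_right.2 (relaysOf_mono hbB k), Finset.sum_const,
      card_relaysOf (hbB.trans hBK), smul_eq_mul, mul_comm]
  have hLY : ∑ i, LY i = K * n + dY := by
    simp [LY, Finset.sum_add_distrib]
  refine ⟨c.toScheme (M := n * d + dS) finProdFinEquiv
    (finProdFinEquiv.toEmbedding.trans (Fin.castAddEmb dS)) hbB (Nat.mul_pos hn hb) LX
    (n * b + dX) hLX LY (n + dZ) (fun k i hi => ?_) (fun i => ?_) (Nat.le_add_right _ _), ?_⟩
  · simp [LX, hi]
  · simp [LY]
  · simp only [Scheme.rates, LinearCode.toScheme]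
    rw [← hLY]
    push_cast
    rfl

theorem tendsto_add_floor_div {x y : ℝ} (hxy : x ≤ y) {m : ℕ} (hm : 0 < m) :
    Filter.Tendsto (fun n : ℕ => x + (⌊(y - x) * ((n * m : ℕ) : ℝ)⌋₊ : ℝ) / ((n * m : ℕ) : ℝ))
      Filter.atTop (nhds y) := by
  have h1 : Filter.Tendsto (fun n : ℕ => ((n * m : ℕ) : ℝ)) Filter.atTop Filter.atTop :=
    tendsto_natCast_atTop_atTop.comp (Filter.tendsto_id.atTop_mul_const' hm)
  have h2 := ((tendsto_nat_floor_mul_div_atTop (sub_nonneg.2 hxy)).comp h1).const_add x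
  simpa using h2

/-- A point of the box is the limit, as the number of blocks grows, of the corner rates plus
surpluses rounded down to whole symbols. -/
theorem rateBox_subset_optimalRegion (hb : 1 ≤ b) (hbK : b < K)
    (hq : 2 * K * K + K < Fintype.card F) : rateBox K b ⊆ optimalRegion K b F := by
  obtain ⟨c⟩ := exists_linearCode hb hbK hq
  rintro ⟨x, y, z, w⟩ ⟨hx, hy, hz, hw⟩
  simp only at hx hy hz hw
  have hb0 : (b : ℝ) ≠ 0 := by positivity
  have hK0 : (K : ℝ) ≠ 0 := by
    have : 0 < K := by omega
    positivity
  -- The source key has K - b symbols per block if b ≤ K - b, and b symbols otherwise.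
  have hd : (((K - min b (K - b) : ℕ) : ℝ) / b) = max 1 ((K : ℝ) / b - 1) := by
    rcases le_total b (K - b) with h | h
    · have h' : (b : ℝ) ≤ K - b := by
        have : ((b : ℕ) : ℝ) ≤ ((K - b : ℕ) : ℝ) := by exact_mod_cast h
        rwa [Nat.cast_sub hbK.le] at this
      rw [min_eq_left h, Nat.cast_sub hbK.le, sub_div, div_self hb0, max_eq_right]
      rw [le_sub_iff_add_le, le_div_iff₀ (by positivity)]
      linarith
    · have h' : (K : ℝ) - b ≤ b := by
        have : ((K - b : ℕ) : ℝ) ≤ ((b : ℕ) : ℝ) := by exact_mod_cast h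
        rwa [Nat.cast_sub hbK.le] at this
      rw [min_eq_right h, Nat.sub_sub_self hbK.le, div_self hb0, max_eq_left]
      rw [sub_le_iff_le_add, div_le_iff₀ (by positivity)]
      linarith
  have hlim := (tendsto_add_floor_div hx hb).prodMk_nhds
    ((tendsto_add_floor_div hy (Nat.mul_pos (show 0 < K by omega) hb)).prodMk_nhds
    ((tendsto_add_floor_div hz hb).prodMk_nhds (tendsto_add_floor_div (hd.trans_le hw) hb)))
  refine mem_closure_of_tendsto hlim ?_
  filter_upwards [Filter.eventually_ge_atTop 1] with n hn
  obtain ⟨s, hs⟩ := c.exists_scheme hb le_rfl hbK.le hn ⌊(x - 1) * ((n * b : ℕ) : ℝ)⌋₊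
    ⌊(y - 1 / (b : ℝ)) * ((n * (K * b) : ℕ) : ℝ)⌋₊ ⌊(z - 1 / (b : ℝ)) * ((n * b : ℕ) : ℝ)⌋₊
    ⌊(w - ((K - min b (K - b) : ℕ) : ℝ) / b) * ((n * b : ℕ) : ℝ)⌋₊
  refine ⟨s, hs.trans ?_⟩
  have hn0 : (n : ℝ) ≠ 0 := by positivity
  refine Prod.ext ?_ (Prod.ext ?_ (Prod.ext ?_ ?_)) <;> simp only <;> push_cast <;> field_simp

/-- One block of the code with b = K - 1 is used: each user leaves one of its K relays idle, and K -
1 source symbols suffice. -/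
theorem corner_mem_achievableRates (hK : 2 ≤ K) (hq : 2 * K * K + K < Fintype.card F) :
    ((1, 1 / ((K : ℝ) - 1), 1 / ((K : ℝ) - 1), 1) : ℝ × ℝ × ℝ × ℝ) ∈ achievableRates K K F := by
  obtain ⟨c⟩ := exists_linearCode (b := K - 1) (by omega) (by omega) hq
  obtain ⟨s, hs⟩ := c.exists_scheme (by omega) (Nat.sub_le K 1) le_rfl le_rfl 0 0 0 0
  refine ⟨s, hs.trans ?_⟩
  have h1 : K - min (K - 1) (K - (K - 1)) = K - 1 := by omega
  have hK1 : (0 : ℝ) < (K : ℝ) - 1 := by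
    have : (2 : ℝ) ≤ K := by exact_mod_cast hK
    linarith
  have hK0 : (K : ℝ) ≠ 0 := by linarith
  have hK1' := hK1.ne'
  rw [h1]
  simp only [one_mul, mul_one, add_zero, Nat.cast_sub (show 1 ≤ K by omega), Nat.cast_one]
  refine Prod.ext ?_ (Prod.ext ?_ (Prod.ext ?_ ?_)) <;> simp only <;> field_simp

end Region

end HSA

theorem theorem1 (K : ℕ) (hK : 2 ≤ K) :
    (∀ B : ℕ, 1 ≤ B → B ≤ K - 1 →
      (∀ (F : Type) [Field F] [Fintype F], HSA.optimalRegion K B F ⊆ HSA.rateBox K B) ∧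
      ∃ q₀ : ℕ, ∀ (F : Type) [Field F] [Fintype F], q₀ ≤ Fintype.card F →
        HSA.optimalRegion K B F = HSA.rateBox K B) ∧
    (∀ (F : Type) [Field F] [Fintype F], ∀ r ∈ HSA.optimalRegion K K F,
      1 ≤ r.1 ∧ 1 / ((K : ℝ) - 1) ≤ r.2.1 ∧ 1 / (K : ℝ) ≤ r.2.2.1 ∧ 1 ≤ r.2.2.2) ∧
    ∃ q₀ : ℕ, ∀ (F : Type) [Field F] [Fintype F], q₀ ≤ Fintype.card F →
      ((1, 1 / ((K : ℝ) - 1), 1 / ((K : ℝ) - 1), 1) : ℝ × ℝ × ℝ × ℝ) ∈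
        HSA.achievableRates K K F ∧
      IsLeast ((fun r => r.1) '' HSA.optimalRegion K K F) 1 ∧
      IsLeast ((fun r => r.2.1) '' HSA.optimalRegion K K F) (1 / ((K : ℝ) - 1)) ∧
      IsLeast ((fun r => r.2.2.2) '' HSA.optimalRegion K K F) 1 ∧
      ∃ m : ℝ, IsGLB ((fun r => r.2.2.1) '' HSA.optimalRegion K K F) m ∧
        1 / ((K : ℝ) - 1) ≤ 2 * m := by
  have hbox : ∀ B : ℕ, 1 ≤ B → B ≤ K - 1 → ∀ (F : Type) [Field F] [Fintype F],
      HSA.optimalRegion K B F ⊆ HSA.rateBox K B := by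
    intro B hB1 hB F _ _ r hr
    obtain ⟨h1, h2, -, h3, h4⟩ := HSA.optimalRegion_bounds hK hB1 (by omega) hr
    exact ⟨h1, h2, h3, h4⟩
  have hfull : ∀ (F : Type) [Field F] [Fintype F], ∀ r ∈ HSA.optimalRegion K K F,
      1 ≤ r.1 ∧ 1 / ((K : ℝ) - 1) ≤ r.2.1 ∧ 1 / (K : ℝ) ≤ r.2.2.1 ∧ 1 ≤ r.2.2.2 := by
    intro F _ _ r hr
    obtain ⟨h1, -, h2, h3, h4⟩ := HSA.optimalRegion_bounds hK (by omega) le_rfl hr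
    exact ⟨h1, h2, h3, (le_max_left _ _).trans h4⟩
  refine ⟨fun B hB1 hB => ⟨hbox B hB1 hB, 2 * K * K + K + 1, fun F _ _ hq =>
    (hbox B hB1 hB F).antisymm (HSA.rateBox_subset_optimalRegion hB1 (by omega) (by omega))⟩,
    hfull, 2 * K * K + K + 1, fun F _ _ hq => ?_⟩
  have hc := HSA.corner_mem_achievableRates (F := F) hK (by omega)
  have hc' : _ ∈ HSA.optimalRegion K K F := subset_closure hc
  refine ⟨hc, ⟨⟨_, hc', rfl⟩, ?_⟩, ⟨⟨_, hc', rfl⟩, ?_⟩, ⟨⟨_, hc', rfl⟩, ?_⟩, ?_⟩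
  · rintro _ ⟨r, hr, rfl⟩; exact (hfull F r hr).1
  · rintro _ ⟨r, hr, rfl⟩; exact (hfull F r hr).2.1
  · rintro _ ⟨r, hr, rfl⟩; exact (hfull F r hr).2.2.2
  · have hlb : 1 / (K : ℝ) ∈ lowerBounds ((fun r => r.2.2.1) '' HSA.optimalRegion K K F) := by
      rintro _ ⟨r, hr, rfl⟩; exact (hfull F r hr).2.2.1
    have hglb := Real.isGLB_sInf (Set.Nonempty.image (fun r : ℝ × ℝ × ℝ × ℝ => r.2.2.1) ⟨_, hc'⟩) ⟨_, hlb⟩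
    refine ⟨_, hglb, ?_⟩
    have hle := hglb.2 hlb
    have hK2 : (2 : ℝ) ≤ K := by exact_mod_cast hK
    -- Equivalent to K ≤ 2(K - 1), that is, to K ≥ 2.
    have h2 : 1 / ((K : ℝ) - 1) ≤ 2 * (1 / (K : ℝ)) := by
      rw [mul_one_div, div_le_div_iff₀ (by linarith) (by linarith)]
      linarith
    linarith
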